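/- **Definitions.** Let $E$ be a Banach space and $1\le p<\infty$. $L^p_{loc}(\mathbb R,E)$ is the set of functions $u:\mathbb R\to E$ whose restriction to every bounded interval is in $L^p$ (Bochner, Lebesgue measure). The Bochner transform of $u\in L^p_{loc}(\mathbb R,E)$ is $u^b:\mathbb R\to L^p(0,1;E)$, $u^b(t)(\theta)=u(t+\theta)$. A continuous function $v$ from $\mathbb R$ to a Banach space is *almost periodic* if for every $\varepsilon>0$ there is $\ell>0$ such that every closed interval of length $\ell$ contains a $\tau$ with $\sup_{t\in\mathbb R}\|v(t+\tau)-v(t)\|\le\varepsilon$; it is *almost automorphic* if every real sequence has a subsequence $(t_k)$ for which there is a function $w$ on $\mathbb R$ with $v(t+t_k)\to w(t)$ and $w(t-t_k)\to v(t)$ for all $t\in\mathbb R$. $S^p_{ap}(\mathbb R,E)$ (resp. $S^p_{aa}(\mathbb R,E)$) is the space of all $u\in L^p_{loc}(\mathbb R,E)$ such that $u^b$ is almost periodic (resp. almost automorphic); functions equal a.e. are identified, and the norm is $\|u\|_{S^p}=\sup_{t\in\mathbb R}\big(\int_0^1\|u(t+\theta)\|^p\,d\theta\big)^{1/p}$.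 **Theorem.** Let $X$ and $Y$ be Banach spaces, $p,q\in[1,+\infty)$, and let $f:\mathbb R\times X\to Y$ satisfy: * **(H1)** there exist $a>0$ and $b\in S^q_{aa}(\mathbb R,\mathbb R)$ such that for all $x\in X$, $\|f(t,x)\|\le a\|x\|^{p/q}+b(t)$ for a.e. $t\in\mathbb R$; * **(H2)** for a.e. $t\in\mathbb R$, the map $f(t,\cdot):X\to Y$ is continuous; * **(H3)** for every compact set $K\subset X$ and every $r>0$ there exists a Lebesgue measurable set $N\subset\mathbb R$ such that $\sup_{t\in\mathbb R}\operatorname{meas}\big((t,t+1)\cap N\big)<r$ and $$\forall\varepsilon>0,\ \exists\delta>0,\ \forall x_1,x_2\in K,\ \forall t\in\mathbb R\setminus N,\quad \|x_1-x_2\|\le\delta\implies\|f(t,x_1)-f(t,x_2)\|\le\varepsilon .$$ Let $\mathcal N_f(u)(t)=f(t,u(t))$ for $t\in\mathbb R$. Then: i) If $f(\cdot,x)\in S^q_{aa}(\mathbb R,Y)$ for all $x\in X$, then $\mathcal N_f$ maps $S^p_{aa}(\mathbb R,X)$ into $S^q_{aa}(\mathbb R,Y)$ and $\mathcal N_f:S^p_{aa}(\mathbb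 R,X)\to S^q_{aa}(\mathbb R,Y)$ is continuous. ii) If $f(\cdot,x)\in S^q_{ap}(\mathbb R,Y)$ for all $x\in X$, then $\mathcal N_f$ maps $S^p_{ap}(\mathbb R,X)$ into $S^q_{ap}(\mathbb R,Y)$ and $\mathcal N_f:S^p_{ap}(\mathbb R,X)\to S^q_{ap}(\mathbb R,Y)$ is continuous. -/

import Mathlib

open MeasureTheory Set Filter Topology
open scoped ENNReal

namespace Stepanov

noncomputable section

/-- Lebesgue measure on the interval `(0, 1)`. -/
abbrev unitMeasure : Measure ℝ := volume.restrict (Ioo (0 : ℝ) 1)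

theorem measurePreserving_shift (t : ℝ) :
    MeasurePreserving (fun θ : ℝ => t + θ) unitMeasure (volume.restrict (Ioo t (t + 1))) := by
  have h := (measurePreserving_add_left (volume : Measure ℝ) t).restrict_preimage
    (s := Ioo t (t + 1)) measurableSet_Ioo
  have hs : (fun θ : ℝ => t + θ) ⁻¹' Ioo t (t + 1) = Ioo 0 1 := by
    ext θ; simp
  rwa [hs] at h

section Functions

variable {E : Type*} [NormedAddCommGroup E]

/-- `D ⊆ ℝ` is relatively dense: some length `ℓ > 0` is such that every closed interval of
length `ℓ` meets `D`. -/
def RelativelyDense (D : Set ℝ) : Prop :=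
  ∃ ℓ : ℝ, 0 < ℓ ∧ ∀ α : ℝ, (D ∩ Icc α (α + ℓ)).Nonempty

/-- The set of `ε`-almost periods of `u`. -/
def almostPeriods (u : ℝ → E) (ε : ℝ) : Set ℝ :=
  {τ : ℝ | ∀ t : ℝ, ‖u (t + τ) - u t‖ ≤ ε}

/-- Almost periodic functions in the sense of Bohr. -/
def IsAlmostPeriodic (u : ℝ → E) : Prop :=
  Continuous u ∧ ∀ ε : ℝ, 0 < ε → RelativelyDense (almostPeriods u ε)

/-- (Continuous) almost automorphic functions. -/
def IsAlmostAutomorphic (u : ℝ → E) : Prop :=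
  Continuous u ∧ ∀ s : ℕ → ℝ, ∃ φ : ℕ → ℕ, StrictMono φ ∧ ∃ v : ℝ → E, ∀ t : ℝ,
    Tendsto (fun k => u (t + s (φ k))) atTop (𝓝 (v t)) ∧
    Tendsto (fun k => v (t - s (φ k))) atTop (𝓝 (u t))

/-- `u ∈ L^p_loc(ℝ, E)`: the restriction of `u` to every bounded interval is in `L^p`. -/
def MemLpLoc (p : ℝ≥0∞) (u : ℝ → E) : Prop :=
  ∀ a b : ℝ, MemLp u p (volume.restrict (Ioo a b))

theorem MemLpLoc.memLp_shift {p : ℝ≥0∞} {u : ℝ → E} (hu : MemLpLoc p u) (t : ℝ) :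
    MemLp (fun θ : ℝ => u (t + θ)) p unitMeasure :=
  (hu t (t + 1)).comp_measurePreserving (measurePreserving_shift t)

/-- The Bochner transform `u^b : ℝ → L^p(0, 1; E)`, `u^b(t)(θ) = u(t + θ)`. -/
def bochnerTransform {p : ℝ≥0∞} {u : ℝ → E} (hu : MemLpLoc p u) (t : ℝ) : Lp E p unitMeasure :=
  (hu.memLp_shift t).toLp (fun θ : ℝ => u (t + θ))

/-- `u ∈ S^p_ap(ℝ, E)`: `u ∈ L^p_loc` and its Bochner transform is Bohr almost periodic. -/
def MemSap (p : ℝ≥0∞) [Fact (1 ≤ p)] (u : ℝ → E) : Prop :=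
  ∃ hu : MemLpLoc p u, IsAlmostPeriodic (bochnerTransform hu)

/-- `u ∈ S^p_aa(ℝ, E)`: `u ∈ L^p_loc` and its Bochner transform is almost automorphic. -/
def MemSaa (p : ℝ≥0∞) [Fact (1 ≤ p)] (u : ℝ → E) : Prop :=
  ∃ hu : MemLpLoc p u, IsAlmostAutomorphic (bochnerTransform hu)

/-- The Stepanov norm `sup_t (∫_0^1 ‖u(t + θ)‖^p dθ)^{1/p}`, as an extended nonnegative number. -/
def stepanovNorm (p : ℝ≥0∞) (u : ℝ → E) : ℝ≥0∞ :=
  ⨆ t : ℝ, eLpNorm (fun θ : ℝ => u (t + θ)) p unitMeasure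

theorem stepanovNorm_eq (p : ℝ≥0∞) {u : ℝ → E} (hu : AEStronglyMeasurable u volume) :
    stepanovNorm p u = ⨆ t : ℝ, eLpNorm u p (volume.restrict (Ioo t (t + 1))) :=
  iSup_congr fun t => eLpNorm_comp_measurePreserving hu.restrict (measurePreserving_shift t)

theorem stepanovNorm_add_le (p : ℝ≥0∞) [hp : Fact (1 ≤ p)] {u v : ℝ → E}
    (hu : AEStronglyMeasurable u volume) (hv : AEStronglyMeasurable v volume) :
    stepanovNorm p (u + v) ≤ stepanovNorm p u + stepanovNorm p v := by
  rw [stepanovNorm_eq p hu, stepanovNorm_eq p hv, stepanovNorm_eq p (hu.add hv)]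
  refine iSup_le fun t => (eLpNorm_add_le hu.restrict hv.restrict hp.out).trans ?_
  exact add_le_add (le_iSup (fun t : ℝ => eLpNorm u p (volume.restrict (Ioo t (t + 1)))) t)
    (le_iSup (fun t : ℝ => eLpNorm v p (volume.restrict (Ioo t (t + 1)))) t)

theorem ae_eq_zero_of_stepanovNorm (p : ℝ≥0∞) [hp : Fact (1 ≤ p)] {u : ℝ → E}
    (hu : AEStronglyMeasurable u volume) (h : stepanovNorm p u = 0) : u =ᵐ[volume] 0 := by
  rw [stepanovNorm_eq p hu, ENNReal.iSup_eq_zero] at h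
  have hp0 : p ≠ 0 := (zero_lt_one.trans_le hp.out).ne'
  refine measure_null_of_locally_null _ fun x _ => ?_
  have hx := (eLpNorm_eq_zero_iff hu.restrict hp0).1 (h (x - 1 / 2))
  refine ⟨_, inter_mem_nhdsWithin _ (isOpen_Ioo.mem_nhds
    (show x ∈ Ioo (x - 1 / 2) (x - 1 / 2 + 1) from ⟨by linarith, by linarith⟩)), ?_⟩
  have h2 := (ae_restrict_iff' measurableSet_Ioo).1 hx
  refine measure_mono_null ?_ h2
  rintro y ⟨hy1, hy2⟩ hy
  exact hy1 (hy hy2)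

/-- The Stepanov distance of two classes of functions modulo a.e. equality. -/
def stepanovEDist (p : ℝ≥0∞) (u v : ℝ →ₘ[volume] E) : ℝ≥0∞ :=
  stepanovNorm p (fun t => u t - v t)

theorem stepanovEDist_self (p : ℝ≥0∞) (u : ℝ →ₘ[volume] E) : stepanovEDist p u u = 0 := by
  simp [stepanovEDist, stepanovNorm]

theorem stepanovEDist_comm (p : ℝ≥0∞) (u v : ℝ →ₘ[volume] E) :
    stepanovEDist p u v = stepanovEDist p v u :=
  iSup_congr fun t => eLpNorm_sub_comm (fun θ : ℝ => u (t + θ)) (fun θ : ℝ => v (t + θ)) p _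

theorem stepanovEDist_triangle (p : ℝ≥0∞) [Fact (1 ≤ p)] (u v w : ℝ →ₘ[volume] E) :
    stepanovEDist p u w ≤ stepanovEDist p u v + stepanovEDist p v w := by
  have h := stepanovNorm_add_le p (u.aestronglyMeasurable.sub v.aestronglyMeasurable)
    (v.aestronglyMeasurable.sub w.aestronglyMeasurable)
  rw [sub_add_sub_cancel] at h
  exact h

theorem eq_of_stepanovEDist (p : ℝ≥0∞) [Fact (1 ≤ p)] {u v : ℝ →ₘ[volume] E}
    (h : stepanovEDist p u v = 0) : u = v := by
  refine AEEqFun.ext ?_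
  filter_upwards [ae_eq_zero_of_stepanovNorm p
    (u.aestronglyMeasurable.sub v.aestronglyMeasurable) h] with t ht
  exact sub_eq_zero.1 ht

end Functions

/-- The space `S^p_aa(ℝ, E)`, functions being identified when they are equal a.e. -/
@[ext] structure Saa (p : ℝ≥0∞) [Fact (1 ≤ p)] (E : Type*) [NormedAddCommGroup E] where
  toAEEqFun : ℝ →ₘ[volume] E
  mem : MemSaa p (toAEEqFun : ℝ → E)

/-- The space `S^p_ap(ℝ, E)`, functions being identified when they are equal a.e. -/
@[ext] structure Sap (p : ℝ≥0∞) [Fact (1 ≤ p)] (E : Type*) [NormedAddCommGroup E] where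
  toAEEqFun : ℝ →ₘ[volume] E
  mem : MemSap p (toAEEqFun : ℝ → E)

/-- `S^p_aa(ℝ, E)` carries the (topology of the) distance given by the Stepanov norm. -/
instance (p : ℝ≥0∞) [Fact (1 ≤ p)] (E : Type*) [NormedAddCommGroup E] :
    EMetricSpace (Saa p E) where
  edist u v := stepanovEDist p u.toAEEqFun v.toAEEqFun
  edist_self u := stepanovEDist_self p _
  edist_comm u v := stepanovEDist_comm p _ _
  edist_triangle u v w := stepanovEDist_triangle p _ _ _
  eq_of_edist_eq_zero h := Saa.ext (eq_of_stepanovEDist p h)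

/-- `S^p_ap(ℝ, E)` carries the (topology of the) distance given by the Stepanov norm. -/
instance (p : ℝ≥0∞) [Fact (1 ≤ p)] (E : Type*) [NormedAddCommGroup E] :
    EMetricSpace (Sap p E) where
  edist u v := stepanovEDist p u.toAEEqFun v.toAEEqFun
  edist_self u := stepanovEDist_self p _
  edist_comm u v := stepanovEDist_comm p _ _
  edist_triangle u v w := stepanovEDist_triangle p _ _ _
  eq_of_edist_eq_zero h := Sap.ext (eq_of_stepanovEDist p h)

/-- `sup_t meas((t, t + 1) ∩ N)`. -/
def supMeas (N : Set ℝ) : ℝ≥0∞ :=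
  ⨆ t : ℝ, volume (Ioo t (t + 1) ∩ N)

/-- The Nemytskii operator `u ↦ (t ↦ f(t, u(t)))`, on functions. -/
def nemytskii {X Y : Type*} (f : ℝ → X → Y) (u : ℝ → X) : ℝ → Y :=
  fun t => f t (u t)

end

end Stepanov

/-! Everything rests on compactness of the orbit of the Bochner transform. If `u` is Stepanov almost
periodic or almost automorphic, the range of `u^b` is totally bounded in `L^p(0,1;X)`. Total
boundedness gives uniform integrability (`exists_forall_mem_eLpNorm_indicator_le`) and tightness
(`exists_isCompact_forall_mem_measure_le`): one compact `K` contains `u(t + θ)` for all `θ` off a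
set of small measure, uniformly in `t`.

Take a partition of unity `φ_x` on `K`, finer than the modulus that H3 provides off `N`. Then `f(t,
u(t))` is close to `∑ φ_x(u(t)) f(t, x)` when `u(t) ∈ K` and `t ∉ N`. On the remaining small set the
growth bound H1 and uniform integrability control the error (`exists_eLpNorm_le_of_dominated`).
Hence the sums converge to `f(·, u(·))` in the Stepanov norm.

Each sum stays in the class: `(w, g) ↦ φ(w) g` is continuous from `L^p × L^q` to `L^q`
(`continuous_compSmulLp`), and both classes are stable under pairs, continuous images and uniform
limits.

For continuity, if `u_n → v`, then the orbits of `v` and of all `u_n` together are totally bounded.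
One `K` and one integrability threshold therefore serve every `n`, and the same splitting applies.
-/

namespace Stepanov

/-! ### Bohr almost periodic functions. -/

section AlmostPeriodic

variable {E F G : Type*} [NormedAddCommGroup E] [NormedAddCommGroup F] [NormedAddCommGroup G]

/-- An almost period moves two nearby points into one fixed compact interval, where Heine–Cantor
applies. -/
theorem IsAlmostPeriodic.uniformContinuous {u : ℝ → E} (hu : IsAlmostPeriodic u) :
    UniformContinuous u := by
  rw [Metric.uniformContinuous_iff]
  intro ε hε
  obtain ⟨ℓ, hℓ, h⟩ := hu.2 (ε / 4) (by positivity)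
  have hc : UniformContinuousOn u (Icc (-1) (ℓ + 1)) :=
    isCompact_Icc.uniformContinuousOn_of_continuous hu.1.continuousOn
  obtain ⟨δ, hδ, hd⟩ := Metric.uniformContinuousOn_iff.1 hc (ε / 4) (by positivity)
  refine ⟨min δ 1, by positivity, fun {s t} hst => ?_⟩
  obtain ⟨τ, hτ, hτ1, hτ2⟩ := h (-s)
  rw [Real.dist_eq, lt_min_iff, abs_lt, abs_lt] at hst
  have h1 := hτ s
  have h2 := hτ t
  have h3 := hd (s + τ) ⟨by linarith, by linarith⟩ (t + τ) ⟨by linarith, by linarith⟩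
    (by rw [Real.dist_eq, abs_lt]; constructor <;> linarith)
  have h4 := dist_triangle4 (u s) (u (s + τ)) (u (t + τ)) (u t)
  rw [dist_comm (u s) (u (s + τ)), dist_eq_norm (u (s + τ)) (u s),
    dist_eq_norm (u (t + τ)) (u t)] at h4
  linarith

/-- The translates of an almost periodic function form a totally bounded family. -/
theorem IsAlmostPeriodic.exists_finite_net {u : ℝ → E} (hu : IsAlmostPeriodic u) {ε : ℝ}
    (hε : 0 < ε) :
    ∃ D : Set ℝ, D.Finite ∧ ∀ s, ∃ c ∈ D, ∀ t, ‖u (t + s) - u (t + c)‖ ≤ ε := by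
  obtain ⟨δ, hδ, hd⟩ := Metric.uniformContinuous_iff.1 hu.uniformContinuous (ε / 2)
    (by positivity)
  obtain ⟨ℓ, hℓ, h⟩ := hu.2 (ε / 2) (by positivity)
  obtain ⟨D, hD, hcov⟩ := Metric.totallyBounded_iff.1
    (isCompact_Icc (a := (0 : ℝ)) (b := ℓ)).totallyBounded δ hδ
  refine ⟨D, hD, fun s => ?_⟩
  obtain ⟨τ, hτ, hτ1, hτ2⟩ := h (s - ℓ)
  obtain ⟨c, hc, hcs⟩ := mem_iUnion₂.1
    (hcov (show s - τ ∈ Icc 0 ℓ from ⟨by linarith, by linarith⟩))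
  refine ⟨c, hc, fun t => ?_⟩
  have h1 := hτ (t + (s - τ))
  rw [show t + (s - τ) + τ = t + s by ring] at h1
  have h2 : dist (u (t + (s - τ))) (u (t + c)) < ε / 2 := hd (by
    rw [dist_add_left]; exact hcs)
  rw [dist_eq_norm] at h2
  have h3 := norm_sub_le_norm_sub_add_norm_sub (u (t + s)) (u (t + (s - τ))) (u (t + c))
  linarith

/-- Converse half of Bochner's criterion. Finite nets of translates pass to pairs and continuous
images, whereas common almost periods of two functions are not visible from the definition. -/
theorem isAlmostPeriodic_of_finite_net {u : ℝ → E} (hu : Continuous u)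
    (h : ∀ ε : ℝ, 0 < ε →
      ∃ D : Set ℝ, D.Finite ∧ ∀ s, ∃ c ∈ D, ∀ t, ‖u (t + s) - u (t + c)‖ ≤ ε) :
    IsAlmostPeriodic u := by
  refine ⟨hu, fun ε hε => ?_⟩
  obtain ⟨D, hD, hcov⟩ := h ε hε
  obtain ⟨R, hR, hDR⟩ := hD.isBounded.exists_pos_norm_le
  refine ⟨2 * R, by positivity, fun α => ?_⟩
  -- Since `|c| ≤ R`, the difference `α + R - c` lies in `[α, α + 2R]`.
  obtain ⟨c, hc, hcs⟩ := hcov (α + R)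
  have hcR := hDR c hc
  rw [Real.norm_eq_abs, abs_le] at hcR
  refine ⟨α + R - c, fun t => ?_, by linarith, by linarith⟩
  have := hcs (t - c)
  rwa [sub_add_cancel, show t - c + (α + R) = t + (α + R - c) by ring] at this

theorem IsAlmostPeriodic.prodMk {u : ℝ → E} {v : ℝ → F} (hu : IsAlmostPeriodic u)
    (hv : IsAlmostPeriodic v) : IsAlmostPeriodic (fun t => (u t, v t)) := by
  refine isAlmostPeriodic_of_finite_net (hu.1.prodMk hv.1) fun ε hε => ?_
  obtain ⟨D, hD, hDu⟩ := hu.exists_finite_net (half_pos hε)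
  obtain ⟨D', hD', hDv⟩ := hv.exists_finite_net (half_pos hε)
  choose c hc hcu using hDu
  choose d hd hdv using hDv
  -- Only finitely many pairs of centres occur; one representative translate per pair gives a common
  -- net, at the cost of a factor 2.
  have hfin : (range fun s => (c s, d s)).Finite :=
    (hD.prod hD').subset (by rintro _ ⟨s, rfl⟩; exact ⟨hc s, hd s⟩)
  have hrep : ∀ x : range fun s => (c s, d s), ∃ s, (c s, d s) = x.1 := fun x => x.2
  choose rep hrep using hrep
  have := hfin.to_subtype
  refine ⟨range rep, finite_range rep, fun s => ⟨rep ⟨_, s, rfl⟩, mem_range_self _, fun t => ?_⟩⟩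
  have h := hrep ⟨_, s, rfl⟩
  set r := rep ⟨_, s, rfl⟩
  simp only [Prod.mk.injEq] at h
  rw [Prod.mk_sub_mk, Prod.norm_def, sup_le_iff]
  have h1 := hcu s t
  have h2 := hcu r t
  have h3 := hdv s t
  have h4 := hdv r t
  rw [h.1, norm_sub_rev] at h2
  rw [h.2, norm_sub_rev] at h4
  have h5 := norm_sub_le_norm_sub_add_norm_sub (u (t + s)) (u (t + c s)) (u (t + r))
  have h6 := norm_sub_le_norm_sub_add_norm_sub (v (t + s)) (v (t + d s)) (v (t + r))
  exact ⟨by simp only; linarith, by simp only; linarith⟩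

theorem IsAlmostPeriodic.totallyBounded_range {u : ℝ → E} (hu : IsAlmostPeriodic u) :
    TotallyBounded (range u) := by
  rw [Metric.totallyBounded_iff]
  intro ε hε
  obtain ⟨D, hD, h⟩ := hu.exists_finite_net (half_pos hε)
  refine ⟨u '' D, hD.image u, ?_⟩
  rintro _ ⟨s, rfl⟩
  obtain ⟨c, hc, hcs⟩ := h s
  refine mem_iUnion₂.2 ⟨u c, mem_image_of_mem u hc, ?_⟩
  have := hcs 0
  rw [zero_add, zero_add] at this
  rw [Metric.mem_ball, dist_eq_norm]
  linarith

/-- Completeness makes the closure of the range compact, so `Φ` is uniformly continuous there. -/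
theorem IsAlmostPeriodic.comp [CompleteSpace E] {u : ℝ → E} (hu : IsAlmostPeriodic u) {Φ : E → G}
    (hΦ : Continuous Φ) : IsAlmostPeriodic (fun t => Φ (u t)) := by
  refine isAlmostPeriodic_of_finite_net (hΦ.comp hu.1) fun ε hε => ?_
  have hK : IsCompact (closure (range u)) := 
    hu.totallyBounded_range.closure.isCompact_of_isClosed isClosed_closure
  obtain ⟨δ, hδ, hd⟩ := Metric.uniformContinuousOn_iff.1
    (hK.uniformContinuousOn_of_continuous hΦ.continuousOn) ε hε
  obtain ⟨D, hD, h⟩ := hu.exists_finite_net (half_pos hδ)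
  refine ⟨D, hD, fun s => ?_⟩
  obtain ⟨c, hc, hcs⟩ := h s
  refine ⟨c, hc, fun t => ?_⟩
  rw [← dist_eq_norm]
  refine (hd _ (subset_closure (mem_range_self _)) _ (subset_closure (mem_range_self _)) ?_).le
  rw [dist_eq_norm]
  linarith [hcs t]

theorem continuous_of_forall_exists_norm_sub_le {u : ℝ → E}
    (h : ∀ ε : ℝ, 0 < ε → ∃ v : ℝ → E, Continuous v ∧ ∀ t, ‖u t - v t‖ ≤ ε) : Continuous u := by
  refine continuous_of_uniform_approx_of_continuous fun s hs => ?_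
  obtain ⟨ε, hε, hs⟩ := Metric.mem_uniformity_dist.1 hs
  obtain ⟨v, hv, huv⟩ := h (ε / 2) (half_pos hε)
  exact ⟨v, hv, fun t => hs (by rw [dist_eq_norm]; linarith [huv t])⟩

theorem isAlmostPeriodic_of_forall_exists_norm_sub_le {u : ℝ → E}
    (h : ∀ ε : ℝ, 0 < ε → ∃ v : ℝ → E, IsAlmostPeriodic v ∧ ∀ t, ‖u t - v t‖ ≤ ε) :
    IsAlmostPeriodic u := by
  refine ⟨continuous_of_forall_exists_norm_sub_le fun ε hε => ?_, fun ε hε => ?_⟩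
  · obtain ⟨v, hv, huv⟩ := h ε hε
    exact ⟨v, hv.1, huv⟩
  · obtain ⟨v, hv, huv⟩ := h (ε / 3) (by positivity)
    obtain ⟨ℓ, hℓ, hd⟩ := hv.2 (ε / 3) (by positivity)
    refine ⟨ℓ, hℓ, fun α => (hd α).mono (inter_subset_inter_left _ fun τ hτ t => ?_)⟩
    have h1 := hτ t
    have h2 := huv t
    have h3 := huv (t + τ)
    rw [norm_sub_rev] at h2
    have h4 := norm_sub_le_norm_sub_add_norm_sub (u (t + τ)) (v (t + τ)) (u t)
    have h5 := norm_sub_le_norm_sub_add_norm_sub (v (t + τ)) (v t) (u t)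
    linarith

end AlmostPeriodic

/-- Diagonal extraction: if every subsequence has a further subsequence that satisfies `P n`, and
`P n` is inherited by sequences that are eventually subsequences, then some subsequence satisfies
all `P n`. -/
theorem exists_strictMono_forall {P : ℕ → (ℕ → ℕ) → Prop}
    (hex : ∀ n (φ : ℕ → ℕ), StrictMono φ → ∃ ψ : ℕ → ℕ, StrictMono ψ ∧ P n (φ ∘ ψ))
    (hP : ∀ n (φ φ' χ : ℕ → ℕ), P n φ → Tendsto χ atTop atTop → φ' =ᶠ[atTop] φ ∘ χ → P n φ') :
    ∃ φ : ℕ → ℕ, StrictMono φ ∧ ∀ n, P n φ := by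
  choose ψ hψ hPψ using hex
  let Φ : ℕ → {φ : ℕ → ℕ // StrictMono φ} := fun n => Nat.rec ⟨id, strictMono_id⟩
    (fun n φ => ⟨φ.1 ∘ ψ n φ.1 φ.2, φ.2.comp (hψ n φ.1 φ.2)⟩) n
  have hΦ : ∀ n, (Φ (n + 1)).1 = (Φ n).1 ∘ ψ n (Φ n).1 (Φ n).2 := fun n => rfl
  have hsub : ∀ n m, ∃ χ : ℕ → ℕ, StrictMono χ ∧ (Φ (n + m)).1 = (Φ n).1 ∘ χ := by
    intro n m
    induction m with
    | zero => exact ⟨id, strictMono_id, rfl⟩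
    | succ m ih =>
      obtain ⟨χ, hχ, h⟩ := ih
      refine ⟨χ ∘ ψ (n + m) (Φ (n + m)).1 (Φ (n + m)).2, hχ.comp (hψ _ _ _), ?_⟩
      rw [← Function.comp_assoc, ← h]
      rfl
  refine ⟨fun k => (Φ k).1 k, strictMono_nat_of_lt_succ fun k => ?_, fun n => ?_⟩
  · rw [hΦ]
    exact (Φ k).2 ((Nat.lt_succ_self k).trans_le ((hψ _ _ _).id_le (k + 1)))
  · choose χ hχ hχΦ using hsub (n + 1)
    -- The truncated subtraction is harmless: the factorization is needed only for `k ≥ n + 1`.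
    refine hP n (Φ (n + 1)).1 _ (fun k => χ (k - (n + 1)) k) (hΦ n ▸ hPψ n _ _)
      (tendsto_atTop_mono (fun k => (hχ _).id_le k) tendsto_id) ?_
    filter_upwards [eventually_ge_atTop (n + 1)] with k hk
    rw [Function.comp_apply, ← Function.comp_apply (f := (Φ (n + 1)).1), ← hχΦ,
      Nat.add_sub_cancel' hk]

theorem exists_seq_separated {α : Type*} {r : α → α → Prop}
    (h : ∀ D : Finset α, ∃ y, ∀ d ∈ D, r y d) : ∃ x : ℕ → α, ∀ n m, m < n → r (x n) (x m) := by
  obtain ⟨x, -, hx⟩ := exists_seq_of_forall_finset_exists (fun _ : α => True) (fun a b => r b a)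
    (fun D _ => by simpa using h D)
  exact ⟨x, fun n m hmn => hx m n hmn⟩

/-! ### Almost automorphic functions. -/

section AlmostAutomorphic

variable {E F G : Type*} [NormedAddCommGroup E] [NormedAddCommGroup F] [NormedAddCommGroup G]

theorem IsAlmostAutomorphic.prodMk {u : ℝ → E} {v : ℝ → F} (hu : IsAlmostAutomorphic u)
    (hv : IsAlmostAutomorphic v) : IsAlmostAutomorphic (fun t => (u t, v t)) := by
  refine ⟨hu.1.prodMk hv.1, fun s => ?_⟩
  obtain ⟨φ, hφ, u', hu'⟩ := hu.2 s
  obtain ⟨ψ, hψ, v', hv'⟩ := hv.2 (s ∘ φ)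
  refine ⟨φ ∘ ψ, hφ.comp hψ, fun t => (u' t, v' t), fun t => ⟨?_, ?_⟩⟩
  · exact ((hu' t).1.comp hψ.tendsto_atTop).prodMk_nhds (hv' t).1
  · exact ((hu' t).2.comp hψ.tendsto_atTop).prodMk_nhds (hv' t).2

theorem IsAlmostAutomorphic.comp {u : ℝ → E} (hu : IsAlmostAutomorphic u) {Φ : E → G}
    (hΦ : Continuous Φ) : IsAlmostAutomorphic (fun t => Φ (u t)) := by
  refine ⟨hΦ.comp hu.1, fun s => ?_⟩
  obtain ⟨φ, hφ, u', hu'⟩ := hu.2 s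
  exact ⟨φ, hφ, fun t => Φ (u' t), fun t =>
    ⟨(hΦ.tendsto _).comp (hu' t).1, (hΦ.tendsto _).comp (hu' t).2⟩⟩

/-- Without a finite net there is a `V`-separated sequence of values `u(s_n)`; the definition at `t
= 0` extracts a convergent subsequence, a contradiction. -/
theorem IsAlmostAutomorphic.totallyBounded_range {u : ℝ → E} (hu : IsAlmostAutomorphic u) :
    TotallyBounded (range u) := by
  intro V hV
  by_contra! h
  obtain ⟨x, hx⟩ : ∃ x : ℕ → range u, ∀ n m, m < n → ((x n : E), (x m : E)) ∉ V := by
    refine exists_seq_separated (r := fun y d : range u => ((y : E), (d : E)) ∉ V) fun D => ?_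
    obtain ⟨y, hy, hyD⟩ := not_subset.1 (h ((↑) '' (D : Set (range u))) (D.finite_toSet.image _))
    refine ⟨⟨y, hy⟩, fun d hd hdV => hyD (mem_iUnion₂.2 ⟨d, mem_image_of_mem _ hd, hdV⟩)⟩
  choose s hs using fun n => (x n).2
  obtain ⟨φ, hφ, v, hv⟩ := hu.2 s
  have hc : CauchySeq fun k => (x (φ k) : E) := by
    have := (hv 0).1.cauchySeq
    simpa only [zero_add, hs] using this
  obtain ⟨N, hN⟩ := hc.mem_entourage hV
  exact hx _ _ (hφ (Nat.lt_succ_self N)) (hN (N + 1) N N.le_succ le_rfl)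

theorem isAlmostAutomorphic_of_forall_exists_norm_sub_le [CompleteSpace E] {u : ℝ → E}
    (h : ∀ ε : ℝ, 0 < ε → ∃ v : ℝ → E, IsAlmostAutomorphic v ∧ ∀ t, ‖u t - v t‖ ≤ ε) :
    IsAlmostAutomorphic u := by
  refine ⟨continuous_of_forall_exists_norm_sub_le fun ε hε => ?_, fun s => ?_⟩
  · obtain ⟨v, hv, huv⟩ := h ε hε
    exact ⟨v, hv.1, huv⟩
  have hpos : ∀ n : ℕ, (0 : ℝ) < 1 / (n + 1) := fun n => Nat.one_div_pos_of_nat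
  choose v hv huv using fun n : ℕ => h _ (hpos n)
  obtain ⟨φ, hφ, hP⟩ := exists_strictMono_forall
    (P := fun n φ => ∃ w : ℝ → E, ∀ t : ℝ,
      Tendsto (fun k => v n (t + s (φ k))) atTop (𝓝 (w t)) ∧
      Tendsto (fun k => w (t - s (φ k))) atTop (𝓝 (v n t)))
    (fun n φ _ => (hv n).2 (s ∘ φ))
    (fun n φ φ' χ ⟨w, hw⟩ hχ he => ⟨w, fun t =>
      ⟨((hw t).1.comp hχ).congr' (by filter_upwards [he] with k hk; simp [hk]),
        ((hw t).2.comp hχ).congr' (by filter_upwards [he] with k hk; simp [hk])⟩⟩)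
  choose w hw using hP
  -- The uniform bounds between approximants pass to the limits `w n`, which are therefore uniformly
  -- Cauchy.
  have hdist : ∀ n m t, dist (w n t) (w m t) ≤ 1 / (n + 1) + 1 / (m + 1) := fun n m t => by
    refine le_of_tendsto ((hw n t).1.dist (hw m t).1) (Eventually.of_forall fun k => ?_)
    refine (dist_triangle_left _ _ (u (t + s (φ k)))).trans ?_
    rw [dist_eq_norm, dist_eq_norm]
    exact add_le_add (huv n _) (huv m _)
  have hlim0 := tendsto_one_div_add_atTop_nhds_zero_nat (𝕜 := ℝ)
  have hcau : ∀ t, ∃ x, Tendsto (fun n => w n t) atTop (𝓝 x) := fun t => by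
    refine cauchySeq_tendsto_of_complete (cauchySeq_of_le_tendsto_0 (fun N : ℕ =>
      1 / ((N : ℝ) + 1) + 1 / ((N : ℝ) + 1)) (fun n m N hn hm => (hdist n m t).trans ?_) ?_)
    · exact add_le_add (Nat.one_div_le_one_div hn) (Nat.one_div_le_one_div hm)
    · simpa using hlim0.add hlim0
  choose w' hw' using hcau
  have hww' : ∀ n t, dist (w n t) (w' t) ≤ 1 / (n + 1) := fun n t => by
    refine le_of_tendsto_of_tendsto (tendsto_const_nhds.dist (hw' t))
      (by simpa using (tendsto_const_nhds (x := (1 : ℝ) / (n + 1))).add hlim0)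
      (Eventually.of_forall fun m => hdist n m t)
  -- Interchange of limits, stated abstractly to serve both the forward and the backward
  -- convergence.
  have key : ∀ (a : ℕ → E) (b : E) (a' : ℕ → ℕ → E) (b' : ℕ → E),
      (∀ n, Tendsto (a' n) atTop (𝓝 (b' n))) → (∀ n k, dist (a' n k) (a k) ≤ 1 / (n + 1)) →
      (∀ n, dist (b' n) b ≤ 1 / (n + 1)) → Tendsto a atTop (𝓝 b) := by
    intro a b a' b' ht ha hb
    rw [Metric.tendsto_nhds]
    intro ε hε
    obtain ⟨n, hn⟩ := exists_nat_one_div_lt (show 0 < ε / 3 by positivity)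
    filter_upwards [Metric.tendsto_nhds.1 (ht n) (ε / 3) (by positivity)] with k hk
    have h1 := dist_triangle4 (a k) (a' n k) (b' n) b
    rw [dist_comm (a k) (a' n k)] at h1
    linarith [ha n k, hb n]
  refine ⟨φ, hφ, w', fun t => ⟨?_, ?_⟩⟩
  · exact key _ _ _ _ (fun n => (hw n t).1)
      (fun n k => by rw [dist_comm, dist_eq_norm]; exact huv n _) (fun n => hww' n t)
  · exact key _ _ _ _ (fun n => (hw n t).2) (fun n k => hww' n _)
      (fun n => by rw [dist_comm, dist_eq_norm]; exact huv n _)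

end AlmostAutomorphic

/-! ### Totally bounded sets in `L^p`: uniform integrability and tightness. -/

section TotallyBoundedLp

variable {α E F : Type*} [MeasurableSpace α] {μ : Measure α} [NormedAddCommGroup E]
  [NormedAddCommGroup F] {p q : ℝ≥0∞}

theorem exists_eLpNorm_indicator_le {f : α → E} (hp : 1 ≤ p) (hp' : p ≠ ∞) (hf : MemLp f p μ)
    {ε : ℝ≥0∞} (hε : ε ≠ 0) :
    ∃ δ : ℝ≥0∞, δ ≠ 0 ∧ ∀ A : Set α, μ A ≤ δ → eLpNorm (A.indicator f) p μ ≤ ε := by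
  obtain ⟨e, he, heε⟩ := ENNReal.lt_iff_exists_nnreal_btwn.1 (pos_iff_ne_zero.2 hε)
  obtain ⟨δ, hδ, h⟩ := hf.eLpNorm_indicator_le hp hp' (ε := e) (by exact_mod_cast he)
  refine ⟨ENNReal.ofReal δ, by simpa using hδ, fun A hA => ?_⟩
  have h1 := h (toMeasurable μ A) (measurableSet_toMeasurable μ A) (by rwa [measure_toMeasurable])
  rw [ENNReal.ofReal_coe_nnreal] at h1
  refine le_trans (eLpNorm_mono fun x => ?_) (h1.trans heε.le)
  exact norm_indicator_le_of_subset (subset_toMeasurable μ A) f x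

/-- Replacing the centres of a finite net by simple functions leaves finitely many values in total,
which is the source of tightness. -/
theorem exists_finite_simpleFunc_net [Fact (1 ≤ p)] (hp : p ≠ ∞) {S : Set (Lp E p μ)}
    (hS : TotallyBounded S) {ε : ℝ≥0∞} (hε : ε ≠ 0) :
    ∃ G : Set (SimpleFunc α E), G.Finite ∧ (∀ g ∈ G, MemLp g p μ) ∧
      ∀ w ∈ S, ∃ g ∈ G, eLpNorm (fun x => w x - g x) p μ ≤ ε := by
  obtain ⟨T, hT, hST⟩ := EMetric.totallyBounded_iff.1 hS (ε / 2) (ENNReal.half_pos hε)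
  choose g hg hgm using fun w : Lp E p μ =>
    (Lp.memLp w).exists_simpleFunc_eLpNorm_sub_lt hp (ENNReal.half_pos hε).ne'
  refine ⟨g '' T, hT.image g, ?_, fun w hw => ?_⟩
  · rintro _ ⟨w, -, rfl⟩
    exact hgm w
  · obtain ⟨w', hw', hww'⟩ := mem_iUnion₂.1 (hST hw)
    refine ⟨g w', mem_image_of_mem g hw', ?_⟩
    rw [Metric.mem_eball, Lp.edist_def] at hww'
    have h1 := eLpNorm_add_le ((Lp.aestronglyMeasurable w).sub (Lp.aestronglyMeasurable w'))
      ((Lp.aestronglyMeasurable w').sub (hgm w').1) (Fact.out : 1 ≤ p)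
    rw [sub_add_sub_cancel] at h1
    refine h1.trans ((add_le_add hww'.le (hg w').le).trans (ENNReal.add_halves ε).le)

/-- Totally bounded subsets of `L^p` are uniformly integrable. -/
theorem exists_forall_mem_eLpNorm_indicator_le [hp1 : Fact (1 ≤ p)] (hp : p ≠ ∞)
    {S : Set (Lp E p μ)} (hS : TotallyBounded S) {ε : ℝ≥0∞} (hε : ε ≠ 0) :
    ∃ δ : ℝ≥0∞, δ ≠ 0 ∧ ∀ w ∈ S, ∀ A : Set α, μ A ≤ δ → eLpNorm (A.indicator w) p μ ≤ ε := by
  obtain ⟨G, hG, hGm, hSG⟩ := exists_finite_simpleFunc_net hp hS (ENNReal.half_pos hε).ne'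
  have hG' : ∃ δ : ℝ≥0∞, δ ≠ 0 ∧ ∀ g ∈ G, ∀ A : Set α, μ A ≤ δ →
      eLpNorm (A.indicator g) p μ ≤ ε / 2 := by
    -- Phrased with a filter so that the finitely many thresholds merge at once.
    have h : ∀ g ∈ G, ∀ᶠ δ in 𝓝[>] (0 : ℝ≥0∞), ∀ A : Set α, μ A ≤ δ →
        eLpNorm (A.indicator g) p μ ≤ ε / 2 := fun g hg => by
      obtain ⟨δ, hδ, h⟩ := exists_eLpNorm_indicator_le hp1.out hp (hGm g hg)
        (ENNReal.half_pos hε).ne'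
      filter_upwards [Ioo_mem_nhdsGT (pos_iff_ne_zero.2 hδ)] with δ' hδ' A hA
      exact h A (hA.trans hδ'.2.le)
    obtain ⟨δ, h1, h2⟩ := ((hG.eventually_all.2 h).and self_mem_nhdsWithin).exists
    exact ⟨δ, (pos_iff_ne_zero.1 h2), h1⟩
  obtain ⟨δ, hδ, h⟩ := hG'
  refine ⟨δ, hδ, fun w hw A hA => ?_⟩
  obtain ⟨g, hg, hwg⟩ := hSG w hw
  set B := toMeasurable μ A
  have hB : MeasurableSet B := measurableSet_toMeasurable μ A
  have h1 : eLpNorm (A.indicator w) p μ ≤ eLpNorm (B.indicator w) p μ :=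
    eLpNorm_mono fun x => norm_indicator_le_of_subset (subset_toMeasurable μ A) _ x
  have h2 : B.indicator w = B.indicator (fun x => w x - g x) + B.indicator g := by
    rw [← indicator_add']
    congr 1
    ext x
    simp
  have h3 := eLpNorm_add_le (((Lp.aestronglyMeasurable w).sub (hGm g hg).1).indicator hB)
    ((hGm g hg).1.indicator hB) hp1.out
  refine h1.trans (h2 ▸ h3.trans ?_)
  refine (add_le_add ((eLpNorm_indicator_le _).trans hwg) (h g hg B ?_)).trans
    (ENNReal.add_halves ε).le
  rwa [measure_toMeasurable]

theorem rpow_inv_ne_zero {r : ℝ} (hr : 0 < r) {η : ℝ≥0∞} (hη : η ≠ 0) : η ^ r⁻¹ ≠ 0 := by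
  rw [Ne, ENNReal.rpow_eq_zero_iff]
  rintro (h | h)
  · exact hη h.1
  · exact absurd h.2 (not_lt.2 (inv_nonneg.2 hr.le))

/-- Chebyshev's inequality; the `p`-th power of the assumed bound is `r ^ p * η`. -/
theorem measure_le_of_eLpNorm_le (hp0 : p ≠ 0) (hp : p ≠ ∞) {f : α → E}
    (hf : AEStronglyMeasurable f μ) {r : ℝ} (hr : 0 < r) {η : ℝ≥0∞}
    (h : eLpNorm f p μ ≤ ENNReal.ofReal r * η ^ p.toReal⁻¹) : μ {x | r ≤ ‖f x‖} ≤ η := by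
  have hpr : 0 < p.toReal := ENNReal.toReal_pos hp0 hp
  set R := ENNReal.ofReal r
  have hR : R ≠ 0 := by simpa [R] using hr
  have hR' : R ≠ ∞ := ENNReal.ofReal_ne_top
  have h2 := (mul_meas_ge_le_pow_eLpNorm' μ hp0 hp hf R).trans (ENNReal.rpow_le_rpow h hpr.le)
  rw [ENNReal.mul_rpow_of_nonneg _ _ hpr.le, ENNReal.rpow_inv_rpow hpr.ne',
    ENNReal.mul_le_mul_iff_right (by simp [ENNReal.rpow_eq_zero_iff, hR, hR'])
    (ENNReal.rpow_ne_top_of_nonneg hpr.le hR')] at h2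
  refine (measure_mono fun x hx => ?_).trans h2
  rw [mem_ofPred_eq, ← ofReal_norm]
  exact ENNReal.ofReal_le_ofReal hx

theorem exists_finite_forall_mem_measure_le [hp1 : Fact (1 ≤ p)] (hp : p ≠ ∞)
    {S : Set (Lp E p μ)} (hS : TotallyBounded S) {r : ℝ} (hr : 0 < r) {η : ℝ≥0∞} (hη : η ≠ 0) :
    ∃ D : Set E, D.Finite ∧ ∀ w ∈ S, μ {x | ∀ y ∈ D, r < dist (w x) y} ≤ η := by
  have hp0 : p ≠ 0 := (zero_lt_one.trans_le hp1.out).ne'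
  obtain ⟨G, hG, hGm, hSG⟩ := exists_finite_simpleFunc_net hp hS (mul_ne_zero
    (ENNReal.ofReal_pos.2 hr).ne' (rpow_inv_ne_zero (ENNReal.toReal_pos hp0 hp) hη))
  refine ⟨⋃ g ∈ G, range g, hG.biUnion fun g _ => g.finite_range, fun w hw => ?_⟩
  obtain ⟨g, hg, hwg⟩ := hSG w hw
  refine (measure_mono fun x hx => ?_).trans (measure_le_of_eLpNorm_le hp0 hp
    ((Lp.aestronglyMeasurable w).sub (hGm g hg).1) hr hwg)
  rw [mem_ofPred_eq, Pi.sub_apply, ← dist_eq_norm]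
  exact (hx (g x) (mem_biUnion hg (mem_range_self x))).le

/-- Totally bounded subsets of `L^p` are uniformly tight. -/
theorem exists_isCompact_forall_mem_measure_le [CompleteSpace E] [Fact (1 ≤ p)] (hp : p ≠ ∞)
    {S : Set (Lp E p μ)} (hS : TotallyBounded S) {η : ℝ≥0∞} (hη : η ≠ 0) :
    ∃ K : Set E, IsCompact K ∧ ∀ w ∈ S, μ {x | w x ∉ K} ≤ η := by
  obtain ⟨η', hη'0, hη'⟩ := ENNReal.exists_pos_sum_of_countable' hη ℕ
  have hpos : ∀ n : ℕ, (0 : ℝ) < 1 / (n + 1) := fun n => Nat.one_div_pos_of_nat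
  choose D hD hDS using fun n =>
    exists_finite_forall_mem_measure_le hp hS (hpos n) (hη'0 n).ne'
  -- Closed and covered by finitely many balls at every scale, hence compact; the exceptional sets
  -- have measures summing to less than `η`.
  refine ⟨⋂ n : ℕ, ⋃ y ∈ D n, Metric.closedBall y (1 / (n + 1)), ?_, fun w hw => ?_⟩
  · refine TotallyBounded.isCompact_of_isClosed ?_ (isClosed_iInter fun n =>
      (hD n).isClosed_biUnion fun y _ => Metric.isClosed_closedBall)
    rw [Metric.totallyBounded_iff]
    intro ε hε
    obtain ⟨n, hn⟩ := exists_nat_one_div_lt hε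
    exact ⟨D n, hD n, (iInter_subset _ n).trans
      (iUnion₂_mono fun y _ => Metric.closedBall_subset_ball hn)⟩
  · refine le_trans (measure_mono fun x hx => ?_)
      ((measure_iUnion_le fun n : ℕ => {x | ∀ y ∈ D n, 1 / ((n : ℝ) + 1) < dist (w x) y}).trans
        ((ENNReal.tsum_le_tsum fun n => hDS n w hw).trans hη'.le))
    simpa using hx

theorem mul_ofReal_toReal_div (hp : p ≠ ∞) (hq0 : q ≠ 0) (hq : q ≠ ∞) :
    q * ENNReal.ofReal (p.toReal / q.toReal) = p := by
  rw [← ENNReal.toReal_div, ENNReal.ofReal_toReal (ENNReal.div_ne_top hp hq0),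
    ENNReal.mul_div_cancel hq0 hq]

/-- The `L^q` norm of `‖w‖ ^ (p/q)` is the `p/q` power of the `L^p` norm of `w`, so uniform
integrability carries over. -/
theorem exists_forall_mem_eLpNorm_indicator_rpow_le [hp1 : Fact (1 ≤ p)] (hp : p ≠ ∞)
    (hq0 : q ≠ 0) (hq : q ≠ ∞) {S : Set (Lp E p μ)} (hS : TotallyBounded S) {ε : ℝ≥0∞}
    (hε : ε ≠ 0) :
    ∃ δ : ℝ≥0∞, δ ≠ 0 ∧ ∀ w ∈ S, ∀ A : Set α, μ A ≤ δ →
      eLpNorm (A.indicator fun x => ‖w x‖ ^ (p.toReal / q.toReal)) q μ ≤ ε := by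
  have hp0 : p ≠ 0 := (zero_lt_one.trans_le hp1.out).ne'
  have hr : 0 < p.toReal / q.toReal :=
    div_pos (ENNReal.toReal_pos hp0 hp) (ENNReal.toReal_pos hq0 hq)
  set r := p.toReal / q.toReal with hrdef
  obtain ⟨δ, hδ, h⟩ := exists_forall_mem_eLpNorm_indicator_le hp hS (rpow_inv_ne_zero hr hε)
  refine ⟨δ, hδ, fun w hw A hA => ?_⟩
  have h1 : (A.indicator fun x => ‖w x‖ ^ r) = fun x => ‖A.indicator w x‖ ^ r := by
    ext x
    by_cases hx : x ∈ A <;> simp [hx, Real.zero_rpow hr.ne']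
  rw [h1, eLpNorm_norm_rpow _ hr, hrdef, mul_ofReal_toReal_div hp hq0 hq]
  exact (ENNReal.rpow_le_rpow (h w hw A hA) hr.le).trans_eq (ENNReal.rpow_inv_rpow hr.ne' ε)

/-- A function which is bounded by `c` off a small set, and which is dominated there in terms of
elements of totally bounded sets, has a small norm. -/
theorem exists_eLpNorm_le_of_dominated [IsProbabilityMeasure μ] [Fact (1 ≤ p)]
    [hq1 : Fact (1 ≤ q)] (hp : p ≠ ∞) (hq : q ≠ ∞) {S : Set (Lp E p μ)} (hS : TotallyBounded S)
    {T : Set (Lp ℝ q μ)} (hT : TotallyBounded T) {C : ℝ} {ε : ℝ≥0∞} (hε : ε ≠ 0) :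
    ∃ δ : ℝ≥0∞, δ ≠ 0 ∧ ∀ w₁ ∈ S, ∀ w₂ ∈ S, ∀ β ∈ T, ∀ A : Set α, μ A ≤ δ →
      ∀ (e : α → F) (c : ℝ), 0 ≤ c → (∀ᵐ x ∂μ, x ∉ A → ‖e x‖ ≤ c) →
      (∀ᵐ x ∂μ, ‖e x‖ ≤ C * (‖w₁ x‖ ^ (p.toReal / q.toReal) + ‖w₂ x‖ ^ (p.toReal / q.toReal) +
        |β x| + 1)) → eLpNorm e q μ ≤ ENNReal.ofReal c + ε := by
  have hq0 : q ≠ 0 := (zero_lt_one.trans_le hq1.out).ne'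
  set r := p.toReal / q.toReal
  -- Four dominating terms cost `ε'` each, multiplied by `‖C‖ₑ`; the `+ 1` keeps the denominator
  -- nonzero.
  set ε' := ε / (‖C‖ₑ * 4 + 1)
  have hd : ‖C‖ₑ * 4 + 1 ≠ ∞ := by finiteness
  have hε' : ε' ≠ 0 := (ENNReal.div_pos hε hd).ne'
  obtain ⟨δ₁, hδ₁, h₁⟩ := exists_forall_mem_eLpNorm_indicator_rpow_le hp hq0 hq hS hε'
  obtain ⟨δ₂, hδ₂, h₂⟩ := exists_forall_mem_eLpNorm_indicator_le hq hT hε'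
  obtain ⟨δ₃, hδ₃, h₃⟩ := exists_eLpNorm_indicator_le hq1.out hq
    (memLp_const (1 : ℝ) : MemLp (fun _ : α => (1 : ℝ)) q μ) hε'
  refine ⟨min δ₁ (min δ₂ δ₃), by simp [min_eq_iff, hδ₁, hδ₂, hδ₃], ?_⟩
  intro w₁ hw₁ w₂ hw₂ β hβ A hA e c hc heA he
  set B := toMeasurable μ A
  have hB : MeasurableSet B := measurableSet_toMeasurable μ A
  rw [← measure_toMeasurable, le_min_iff, le_min_iff] at hA
  obtain ⟨hA₁, hA₂, hA₃⟩ := hA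
  have hm : ∀ w : Lp E p μ, AEStronglyMeasurable (fun x => ‖w x‖ ^ r) μ := fun w =>
    ((Lp.aestronglyMeasurable w).norm.aemeasurable.pow_const r).aestronglyMeasurable
  have hmi := fun w => (hm w).indicator hB
  have hmβ := (Lp.aestronglyMeasurable β).indicator hB
  set g₁ := B.indicator fun x => ‖w₁ x‖ ^ r
  set g₂ := B.indicator fun x => ‖w₂ x‖ ^ r
  set g₃ := B.indicator β
  set g₄ := B.indicator fun _ : α => (1 : ℝ)
  have hm₃ : AEStronglyMeasurable (fun x => ‖g₃ x‖) μ := hmβ.norm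
  have hm₄ : AEStronglyMeasurable g₄ μ := aestronglyMeasurable_const.indicator hB
  have hle : ∀ᵐ x ∂μ, ‖e x‖ ≤
      ‖((fun _ => c : α → ℝ) + C • (g₁ + g₂ + (fun x => ‖g₃ x‖ : α → ℝ) + g₄)) x‖ := by
    filter_upwards [heA, he] with x hx₁ hx₂
    rw [Real.norm_eq_abs]
    refine le_trans ?_ (le_abs_self _)
    by_cases hx : x ∈ B
    · simp only [Pi.add_apply, Pi.smul_apply, smul_eq_mul, g₁, g₂, g₃, g₄, indicator_of_mem hx,
        Real.norm_eq_abs]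
      linarith
    · simp only [Pi.add_apply, Pi.smul_apply, smul_eq_mul, g₁, g₂, g₃, g₄,
        indicator_of_notMem hx, norm_zero, add_zero, mul_zero]
      exact hx₁ fun h => hx (subset_toMeasurable μ A h)
  have hsum : eLpNorm (g₁ + g₂ + (fun x => ‖g₃ x‖ : α → ℝ) + g₄) q μ ≤ 4 * ε' := by
    refine (eLpNorm_add_le (((hmi w₁).add (hmi w₂)).add hm₃) hm₄ hq1.out).trans ?_
    refine (add_le_add_left (eLpNorm_add_le ((hmi w₁).add (hmi w₂)) hm₃ hq1.out) _).trans ?_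
    refine (add_le_add_left (add_le_add_left
      (eLpNorm_add_le (hmi w₁) (hmi w₂) hq1.out) _) _).trans ?_
    rw [eLpNorm_norm]
    refine (add_le_add (add_le_add (add_le_add (h₁ w₁ hw₁ B hA₁) (h₁ w₂ hw₂ B hA₁))
      (h₂ β hβ B hA₂)) (h₃ B hA₃)).trans_eq ?_
    ring
  refine (eLpNorm_mono_ae hle).trans ((eLpNorm_add_le aestronglyMeasurable_const
    ((((hmi w₁).add (hmi w₂)).add hm₃).add hm₄ |>.const_smul C) hq1.out).trans (add_le_add ?_ ?_))
  · rw [eLpNorm_const _ hq0 (IsProbabilityMeasure.ne_zero μ), measure_univ, ENNReal.one_rpow,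
      mul_one, Real.enorm_eq_ofReal hc]
  · rw [eLpNorm_const_smul]
    calc ‖C‖ₑ * eLpNorm (g₁ + g₂ + (fun x => ‖g₃ x‖ : α → ℝ) + g₄) q μ ≤ ‖C‖ₑ * (4 * ε') := by gcongr
      _ ≤ (‖C‖ₑ * 4 + 1) * ε' := by rw [← mul_assoc, add_mul]; exact le_self_add
      _ = ε := ENNReal.mul_div_cancel (by simp) hd

end TotallyBoundedLp

/-! ### Continuity of `(w, g) ↦ φ(w) g`. -/

section SmulLp

variable {α E F : Type*} [MeasurableSpace α] {μ : Measure α} [NormedAddCommGroup E]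
  [NormedAddCommGroup F] [NormedSpace ℝ F] {p q : ℝ≥0∞}

theorem memLp_comp_smul {φ : E → ℝ} (hφ : Continuous φ) (hφ1 : ∀ x, |φ x| ≤ 1) {u : α → E}
    (hu : AEStronglyMeasurable u μ) {g : α → F} (hg : MemLp g q μ) :
    MemLp (fun x => φ (u x) • g x) q μ := by
  refine hg.of_le ((hφ.comp_aestronglyMeasurable hu).smul hg.1) (Eventually.of_forall fun x => ?_)
  rw [norm_smul]
  exact mul_le_of_le_one_left (norm_nonneg _) (hφ1 _)

/-- The map `(u, g) ↦ φ(u) g` from `L^p × L^q` to `L^q`, for a function `φ` which is continuous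
and bounded by `1`. -/
noncomputable def compSmulLp {φ : E → ℝ} (hφ : Continuous φ) (hφ1 : ∀ x, |φ x| ≤ 1)
    (w : Lp E p μ × Lp F q μ) : Lp F q μ :=
  (memLp_comp_smul hφ hφ1 (Lp.aestronglyMeasurable w.1) (Lp.memLp w.2)).toLp
    (fun x => φ (w.1 x) • w.2 x)

theorem continuous_compSmulLp [IsFiniteMeasure μ] [hp1 : Fact (1 ≤ p)] [hq1 : Fact (1 ≤ q)]
    (hq : q ≠ ∞) {φ : E → ℝ} (hφ : Continuous φ) (hφ1 : ∀ x, |φ x| ≤ 1) :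
    Continuous (compSmulLp hφ hφ1 : Lp E p μ × Lp F q μ → Lp F q μ) := by
  rw [continuous_iff_seqContinuous]
  intro w w₀ hw
  have hw1 : Tendsto (fun n => (w n).1) atTop (𝓝 w₀.1) := (continuous_fst.tendsto _).comp hw
  have hw2 : Tendsto (fun n => (w n).2) atTop (𝓝 w₀.2) := (continuous_snd.tendsto _).comp hw
  -- Convergence in `L^p` is almost everywhere only along a subsequence. There Vitali's theorem
  -- handles `φ(w_n) g₀`, and `|φ| ≤ 1` handles `φ(w_n) (g_n - g₀)`.
  refine tendsto_of_subseq_tendsto fun ns hns => ?_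
  obtain ⟨ms, hms, hae⟩ :=
    (tendstoInMeasure_of_tendsto_Lp (hw1.comp hns)).exists_seq_tendsto_ae
  refine ⟨ms, ?_⟩
  have hw2' := hw2.comp (hns.comp hms.tendsto_atTop)
  rw [Lp.tendsto_Lp_iff_tendsto_eLpNorm'] at hw2' ⊢
  set v := fun n => w (ns (ms n)) with hv
  have hmem : ∀ n, MemLp (fun x => φ ((v n).1 x) • w₀.2 x) q μ := fun n =>
    memLp_comp_smul hφ hφ1 (Lp.aestronglyMeasurable _) (Lp.memLp _)
  have hlim : Tendsto (fun n => eLpNorm ((fun x => φ ((v n).1 x) • w₀.2 x) -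
      fun x => φ (w₀.1 x) • w₀.2 x) q μ) atTop (𝓝 0) := by
    refine tendsto_Lp_finite_of_tendsto_ae hq1.out hq (fun n => (hmem n).1)
      (memLp_comp_smul hφ hφ1 (Lp.aestronglyMeasurable _) (Lp.memLp _)) ?_ ?_
    · intro ε hε
      obtain ⟨δ, hδ, h⟩ := (Lp.memLp w₀.2).eLpNorm_indicator_le hq1.out hq hε
      refine ⟨δ, hδ, fun n A hA hAδ => (eLpNorm_mono fun x => ?_).trans (h A hA hAδ)⟩
      by_cases hx : x ∈ A
      · simp only [indicator_of_mem hx, norm_smul]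
        exact mul_le_of_le_one_left (norm_nonneg _) (hφ1 _)
      · simp [hx]
    · filter_upwards [hae] with x hx
      exact ((hφ.tendsto _).comp hx).smul_const _
  have hsum := hw2'.add hlim
  rw [add_zero] at hsum
  refine tendsto_of_tendsto_of_tendsto_of_le_of_le tendsto_const_nhds hsum (fun n => zero_le)
    fun n => ?_
  have hm1 : MemLp (fun x => φ ((v n).1 x) • ((v n).2 x - w₀.2 x)) q μ :=
    memLp_comp_smul hφ hφ1 (Lp.aestronglyMeasurable _) ((Lp.memLp _).sub (Lp.memLp _))
  have hle : eLpNorm (fun x => φ ((v n).1 x) • ((v n).2 x - w₀.2 x)) q μ ≤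
      eLpNorm ((v n).2 - w₀.2 : α → F) q μ := eLpNorm_mono fun x => by
    rw [norm_smul]
    exact mul_le_of_le_one_left (norm_nonneg _) (hφ1 _)
  refine le_trans ?_ (add_le_add_left hle _)
  refine le_trans (eLpNorm_congr_ae ?_).le (eLpNorm_add_le hm1.1 ((hmem n).1.sub
    (memLp_comp_smul hφ hφ1 (Lp.aestronglyMeasurable w₀.1) (Lp.memLp w₀.2)).1) hq1.out)
  filter_upwards [(memLp_comp_smul hφ hφ1 (Lp.aestronglyMeasurable (v n).1)
    (Lp.memLp (v n).2)).coeFn_toLp, (memLp_comp_smul hφ hφ1 (Lp.aestronglyMeasurable w₀.1)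
    (Lp.memLp w₀.2)).coeFn_toLp] with x hx1 hx2
  simp only [Pi.sub_apply, Pi.add_apply, compSmulLp, Function.comp_apply]
  rw [hx2, hv] at *
  simp only at hx1
  rw [hx1, smul_sub]
  abel

end SmulLp

instance : IsProbabilityMeasure unitMeasure := ⟨by simp [unitMeasure]⟩

theorem ae_shift {P : ℝ → Prop} (h : ∀ᵐ s, P s) (t : ℝ) : ∀ᵐ θ ∂unitMeasure, P (t + θ) :=
  (measurePreserving_shift t).quasiMeasurePreserving.ae (ae_restrict_of_ae h)

theorem unitMeasure_shift_le_supMeas {N : Set ℝ} (hN : NullMeasurableSet N) (t : ℝ) :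
    unitMeasure {θ | t + θ ∈ N} ≤ supMeas N := by
  have h := (measurePreserving_shift t).measure_preimage (s := N)
    (hN.mono_ac Measure.restrict_le_self.absolutelyContinuous)
  rw [Measure.restrict_apply₀ (hN.mono_ac Measure.restrict_le_self.absolutelyContinuous),
    inter_comm] at h
  exact h.trans_le (le_iSup (fun t : ℝ => volume (Ioo t (t + 1) ∩ N)) t)

theorem exists_real_pos_ofReal_le {ε : ℝ≥0∞} (hε : ε ≠ 0) :
    ∃ r : ℝ, 0 < r ∧ ENNReal.ofReal r ≤ ε := by
  obtain ⟨e, he, heε⟩ := ENNReal.lt_iff_exists_nnreal_btwn.1 (pos_iff_ne_zero.2 hε)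
  exact ⟨e, by exact_mod_cast he, by rw [ENNReal.ofReal_coe_nnreal]; exact heε.le⟩

theorem add_one_rpow_le {x r : ℝ} (hx : 0 ≤ x) (hr : 0 ≤ r) :
    (x + 1) ^ r ≤ 2 ^ r * (x ^ r + 1) := by
  rcases le_total x 1 with h | h
  · calc (x + 1) ^ r ≤ 2 ^ r := Real.rpow_le_rpow (by positivity) (by linarith) hr
      _ ≤ 2 ^ r * (x ^ r + 1) := by
        refine le_mul_of_one_le_right (by positivity) ?_
        linarith [Real.rpow_nonneg hx r]
  · calc (x + 1) ^ r ≤ (2 * x) ^ r := Real.rpow_le_rpow (by positivity) (by linarith) hr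
      _ = 2 ^ r * x ^ r := Real.mul_rpow (by norm_num) hx
      _ ≤ 2 ^ r * (x ^ r + 1) := by gcongr; linarith

/-! ### Two compactness tools. -/

section Topological

/-- All but finitely many `S n` lie near `S₀`, so a net for `S₀` and the finitely many others
suffices. -/
theorem totallyBounded_union_iUnion {α : Type*} [PseudoEMetricSpace α] {S₀ : Set α}
    {S : ℕ → Set α} (h₀ : TotallyBounded S₀) (h : ∀ n, TotallyBounded (S n))
    (hS : ∀ ε : ℝ≥0∞, ε ≠ 0 → ∀ᶠ n in atTop, ∀ x ∈ S n, ∃ y ∈ S₀, edist x y < ε) :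
    TotallyBounded (S₀ ∪ ⋃ n, S n) := by
  rw [EMetric.totallyBounded_iff]
  intro ε hε
  have hε2 := (ENNReal.half_pos hε.ne')
  obtain ⟨n₀, hn₀⟩ := eventually_atTop.1 (hS (ε / 2) hε2.ne')
  obtain ⟨D, hD, hDS⟩ := EMetric.totallyBounded_iff.1
    (h₀.union ((totallyBounded_biUnion (finite_Iio n₀)).2 fun n _ => h n)) (ε / 2) hε2
  refine ⟨D, hD, ?_⟩
  have key : ∀ x, ∀ y ∈ S₀ ∪ ⋃ n ∈ Iio n₀, S n, edist x y < ε / 2 →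
      x ∈ ⋃ z ∈ D, Metric.eball z ε := by
    intro x y hy hxy
    obtain ⟨z, hz, hyz⟩ := mem_iUnion₂.1 (hDS hy)
    refine mem_iUnion₂.2 ⟨z, hz, (edist_triangle x y z).trans_lt ?_⟩
    exact (ENNReal.add_lt_add hxy hyz).trans_eq (ENNReal.add_halves ε)
  rintro x (hx | hx)
  · exact key x x (Or.inl hx) (by simpa using hε2)
  · obtain ⟨n, hn⟩ := mem_iUnion.1 hx
    rcases lt_or_ge n n₀ with hlt | hge
    · exact key x x (Or.inr (mem_biUnion (show n ∈ Iio n₀ from hlt) hn)) (by simpa using hε2)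
    · obtain ⟨y, hy, hxy⟩ := hn₀ n hge x hn
      exact key x y (Or.inl hy) hxy

/-- A finite partition of unity on a compact set, subordinate to balls of radius `δ`. -/
theorem exists_partition_of_unity {X : Type*} [PseudoMetricSpace X] {K : Set X} (hK : IsCompact K)
    {δ : ℝ} (hδ : 0 < δ) :
    ∃ (D : Finset X) (φ : X → X → ℝ), ↑D ⊆ K ∧ (∀ x, Continuous (φ x)) ∧ (∀ x y, 0 ≤ φ x y) ∧
      (∀ y, ∑ x ∈ D, φ x y ≤ 1) ∧ (∀ y ∈ K, ∑ x ∈ D, φ x y = 1) ∧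
      ∀ x y, φ x y ≠ 0 → dist y x < δ := by
  obtain ⟨D', hDK, hD, hcov⟩ := hK.finite_cover_balls (half_pos hδ)
  lift D' to Finset X using hD
  set ρ : X → X → ℝ := fun x y => max 0 (δ - dist y x) with hρ
  have hρ0 : ∀ x y, 0 ≤ ρ x y := fun x y => le_max_left _ _
  -- Truncating the denominator at `δ / 2` keeps the quotients continuous everywhere. It changes
  -- nothing on `K`, where some centre is within `δ / 2` and contributes at least `δ / 2`.
  have hm : ∀ y, 0 < max (δ / 2) (∑ x ∈ D', ρ x y) := fun y =>
    lt_max_of_lt_left (half_pos hδ)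
  have hρc : ∀ x, Continuous (ρ x) := fun x => by fun_prop
  refine ⟨D', fun x y => ρ x y / max (δ / 2) (∑ x ∈ D', ρ x y), hDK, fun x => ?_,
    fun x y => div_nonneg (hρ0 x y) (hm y).le, fun y => ?_, fun y hy => ?_, fun x y h => ?_⟩
  · exact (hρc x).div (continuous_const.max (continuous_finsetSum _ fun x _ => hρc x))
      fun y => (hm y).ne'
  · rw [← Finset.sum_div, div_le_one (hm y)]
    exact le_max_right _ _
  · rw [← Finset.sum_div, div_eq_one_iff_eq (hm y).ne']
    obtain ⟨x, hx, hyx⟩ := mem_iUnion₂.1 (hcov hy)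
    rw [max_eq_right]
    refine le_trans ?_ (Finset.single_le_sum (fun x _ => hρ0 x y) hx)
    refine le_trans ?_ (le_max_right _ _)
    rw [Metric.mem_ball] at hyx
    linarith
  · by_contra! hd
    exact h (by simp [hρ, hd])

end Topological

/-! ### Estimates for the Nemytskii operator. -/

section Nemytskii

variable {X Y : Type*} [NormedAddCommGroup X] [NormedAddCommGroup Y] {p q : ℝ≥0∞}

theorem MemLpLoc.aestronglyMeasurable {u : ℝ → X} (hu : MemLpLoc p u) :
    AEStronglyMeasurable u volume := by
  have h : (⋃ n : ℕ, Ioo (-n : ℝ) n) = univ := by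
    refine eq_univ_of_forall fun x => ?_
    obtain ⟨n, hn⟩ := exists_nat_gt |x|
    exact mem_iUnion.2 ⟨n, abs_lt.1 hn⟩
  rw [← Measure.restrict_univ (μ := volume), ← h, aestronglyMeasurable_iUnion_iff]
  exact fun n => (hu _ _).1

theorem coeFn_bochnerTransform {u : ℝ → X} (hu : MemLpLoc p u) (t : ℝ) :
    bochnerTransform hu t =ᵐ[unitMeasure] fun θ => u (t + θ) :=
  (hu.memLp_shift t).coeFn_toLp

theorem edist_bochnerTransform_le [Fact (1 ≤ p)] {u v : ℝ → X} (hu : MemLpLoc p u)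
    (hv : MemLpLoc p v) (t : ℝ) :
    edist (bochnerTransform hu t) (bochnerTransform hv t) ≤ stepanovNorm p (fun t => u t - v t) := by
  rw [bochnerTransform, bochnerTransform, Lp.edist_toLp_toLp]
  exact le_iSup (fun t : ℝ => eLpNorm (fun θ : ℝ => u (t + θ) - v (t + θ)) p unitMeasure) t

/-- The superposition of a Carathéodory function and a measurable function is measurable. -/
theorem aestronglyMeasurable_nemytskii {f : ℝ → X → Y}
    (hf : ∀ x, AEStronglyMeasurable (fun t => f t x) volume) (hc : ∀ᵐ t, Continuous (f t))
    {u : ℝ → X} (hu : AEStronglyMeasurable u volume) :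
    AEStronglyMeasurable (nemytskii f u) volume := by
  obtain ⟨v, hv, huv⟩ := hu
  have hs : ∀ s : SimpleFunc ℝ X, AEStronglyMeasurable (fun t => f t (s t)) volume := fun s => by
    classical
    have h : (fun t => f t (s t)) =
        fun t => ∑ y ∈ s.range, (s ⁻¹' {y}).indicator (fun t => f t y) t := by
      ext t
      rw [Finset.sum_eq_single (s t)]
      · simp
      · intro y _ hy
        simp [hy.symm]
      · intro h
        exact absurd (s.mem_range_self t) h
    rw [h]
    exact Finset.aestronglyMeasurable_fun_sum _ fun y _ =>
      (hf y).indicator (s.measurableSet_preimage {y})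
  refine aestronglyMeasurable_of_tendsto_ae atTop (fun n => hs (hv.approx n)) ?_
  filter_upwards [huv, hc] with t ht hct
  rw [nemytskii, ht]
  exact (hct.tendsto _).comp (hv.tendsto_approx t)

/-- The exceptional null set depends on `x`. Simple approximations of `u` involve countably many
`x`, and continuity of `f t` transfers the bound to the limit. -/
theorem ae_norm_nemytskii_le {f : ℝ → X → Y} {a r : ℝ} {b : ℝ → ℝ} (hr : 0 ≤ r)
    (hb : ∀ x, ∀ᵐ t, ‖f t x‖ ≤ a * ‖x‖ ^ r + b t) (hc : ∀ᵐ t, Continuous (f t))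
    {u : ℝ → X} (hu : AEStronglyMeasurable u volume) :
    ∀ᵐ t, ‖f t (u t)‖ ≤ a * ‖u t‖ ^ r + b t := by
  obtain ⟨v, hv, huv⟩ := hu
  have h : ∀ᵐ t, ∀ n, ∀ y ∈ (hv.approx n).range, ‖f t y‖ ≤ a * ‖y‖ ^ r + b t :=
    ae_all_iff.2 fun n => (ae_ball_iff (Finset.countable_toSet _)).2 fun y _ => hb y
  filter_upwards [huv, hc, h] with t ht hct hbt
  rw [ht]
  have hlim := hv.tendsto_approx t
  refine le_of_tendsto_of_tendsto ((hct.tendsto _).comp hlim).norm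
    ((((continuous_norm.rpow_const fun _ => Or.inr hr).tendsto _).comp hlim).const_mul a
      |>.add_const (b t)) (Eventually.of_forall fun n => hbt n _ (SimpleFunc.mem_range_self _ _))

theorem memLpLoc_nemytskii [hp1 : Fact (1 ≤ p)] [hq1 : Fact (1 ≤ q)] (hp : p ≠ ∞) (hq : q ≠ ∞)
    {f : ℝ → X → Y} {a : ℝ} {b : ℝ → ℝ} (hbm : MemLpLoc q b)
    (hb : ∀ x, ∀ᵐ t, ‖f t x‖ ≤ a * ‖x‖ ^ (p.toReal / q.toReal) + b t)
    (hc : ∀ᵐ t, Continuous (f t)) (hf : ∀ x, AEStronglyMeasurable (fun t => f t x) volume)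
    {u : ℝ → X} (hu : MemLpLoc p u) : MemLpLoc q (nemytskii f u) := by
  have hp0 : p ≠ 0 := (zero_lt_one.trans_le hp1.out).ne'
  have hq0 : q ≠ 0 := (zero_lt_one.trans_le hq1.out).ne'
  have hr : 0 < p.toReal / q.toReal :=
    div_pos (ENNReal.toReal_pos hp0 hp) (ENNReal.toReal_pos hq0 hq)
  intro x y
  have h1 : MemLp (fun t => ‖u t‖ ^ (p.toReal / q.toReal)) q (volume.restrict (Ioo x y)) := by
    refine ⟨((hu x y).1.norm.aemeasurable.pow_const _).aestronglyMeasurable, ?_⟩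
    rw [eLpNorm_norm_rpow _ hr, mul_ofReal_toReal_div hp hq0 hq]
    exact ENNReal.rpow_lt_top_of_nonneg hr.le (hu x y).2.ne
  refine ((h1.const_mul a).add (hbm x y)).of_le
    (aestronglyMeasurable_nemytskii hf hc hu.aestronglyMeasurable).restrict ?_
  filter_upwards [ae_restrict_of_ae (ae_norm_nemytskii_le hr.le hb hc hu.aestronglyMeasurable)]
    with t ht
  exact ht.trans (le_abs_self _)

/-- Approximation of `f(·, u(·))` in the Stepanov norm by finite sums of products
`φ(u(·)) f(·, x)`. -/
theorem exists_stepanovNorm_nemytskii_sub_sum_le [CompleteSpace X] [NormedSpace ℝ Y]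
    [hp1 : Fact (1 ≤ p)] [hq1 : Fact (1 ≤ q)] (hp : p ≠ ∞) (hq : q ≠ ∞) {f : ℝ → X → Y} {a : ℝ}
    (ha : 0 < a) {b : ℝ → ℝ} (hbm : MemLpLoc q b)
    (hbT : TotallyBounded (range (bochnerTransform hbm)))
    (hb : ∀ x, ∀ᵐ t, ‖f t x‖ ≤ a * ‖x‖ ^ (p.toReal / q.toReal) + b t)
    (hc : ∀ᵐ t, Continuous (f t))
    (heq : ∀ K : Set X, IsCompact K → ∀ r : ℝ, 0 < r →
      ∃ N : Set ℝ, NullMeasurableSet N volume ∧ supMeas N < ENNReal.ofReal r ∧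
        ∀ ε : ℝ, 0 < ε → ∃ δ : ℝ, 0 < δ ∧ ∀ x₁ ∈ K, ∀ x₂ ∈ K, ∀ t ∉ N,
          ‖x₁ - x₂‖ ≤ δ → ‖f t x₁ - f t x₂‖ ≤ ε)
    {u : ℝ → X} (hu : MemLpLoc p u) (huT : TotallyBounded (range (bochnerTransform hu)))
    {ε : ℝ≥0∞} (hε : ε ≠ 0) :
    ∃ (D : Finset X) (φ : X → X → ℝ), (∀ x, Continuous (φ x)) ∧ (∀ x ∈ D, ∀ y, |φ x y| ≤ 1) ∧
      stepanovNorm q (fun t => nemytskii f u t - ∑ x ∈ D, φ x (u t) • f t x) ≤ ε := by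
  have hp0 : p ≠ 0 := (zero_lt_one.trans_le hp1.out).ne'
  have hq0 : q ≠ 0 := (zero_lt_one.trans_le hq1.out).ne'
  have hr : 0 < p.toReal / q.toReal :=
    div_pos (ENNReal.toReal_pos hp0 hp) (ENNReal.toReal_pos hq0 hq)
  set r := p.toReal / q.toReal with hrdef
  -- In `C`, `a` comes from `f(t, u)`, `a * 2 ^ r` from the sum, and `2` from two copies of `|b|`.
  obtain ⟨δ₀, hδ₀, hcore⟩ := exists_eLpNorm_le_of_dominated (F := Y) hp hq huT hbT (C := a + a * 2 ^ r + 2)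
    (ENNReal.half_pos hε).ne'
  obtain ⟨K, hK, hKu⟩ := exists_isCompact_forall_mem_measure_le hp huT (ENNReal.half_pos hδ₀).ne'
  obtain ⟨s, hs, hsδ⟩ := exists_real_pos_ofReal_le (ENNReal.half_pos hδ₀).ne'
  obtain ⟨N, hNm, hNs, hN⟩ := heq K hK s hs
  obtain ⟨c, hc0, hcε⟩ := exists_real_pos_ofReal_le (ENNReal.half_pos hε).ne'
  obtain ⟨δ, hδ, hNδ⟩ := hN c hc0
  -- Radius `δ` serves the equicontinuity; radius `1` gives `‖x‖ ≤ ‖y‖ + 1` for every active centre,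
  -- hence the growth bound.
  obtain ⟨D, φ, hDK, hφc, hφ0, hφ1, hφK, hφδ⟩ :=
    exists_partition_of_unity hK (lt_min hδ zero_lt_one)
  have hφle : ∀ x ∈ D, ∀ y, φ x y ≤ 1 := fun x hx y =>
    (Finset.single_le_sum (fun x _ => hφ0 x y) hx).trans (hφ1 y)
  refine ⟨D, φ, hφc, fun x hx y => by rw [abs_of_nonneg (hφ0 x y)]; exact hφle x hx y, ?_⟩
  refine iSup_le fun t => ?_
  have hut := coeFn_bochnerTransform hu t
  refine (hcore _ (mem_range_self t) _ (mem_range_self t) _ (mem_range_self t)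
    ({θ | bochnerTransform hu t θ ∉ K} ∪ {θ | t + θ ∈ N}) ?_ _ c hc0.le ?_ ?_).trans
    ((add_le_add_left hcε _).trans (ENNReal.add_halves ε).le)
  · refine (measure_union_le _ _).trans ((add_le_add (hKu _ (mem_range_self t)) ?_).trans
      (ENNReal.add_halves δ₀).le)
    exact (unitMeasure_shift_le_supMeas hNm t).trans (hNs.le.trans hsδ)
  · filter_upwards [hut] with θ hθ hA
    simp only [mem_union, mem_ofPred_eq, hθ, not_or, not_not] at hA
    -- The weights sum to one on `K`, so the error is an average of differences `f(·, u) - f(·, x)`.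
    have h1 : nemytskii f u (t + θ) - ∑ x ∈ D, φ x (u (t + θ)) • f (t + θ) x =
        ∑ x ∈ D, φ x (u (t + θ)) • (f (t + θ) (u (t + θ)) - f (t + θ) x) := by
      simp only [smul_sub, Finset.sum_sub_distrib]
      rw [← Finset.sum_smul, hφK _ hA.1, one_smul, nemytskii]
    rw [h1]
    refine (norm_sum_le _ _).trans ?_
    calc ∑ x ∈ D, ‖φ x (u (t + θ)) • (f (t + θ) (u (t + θ)) - f (t + θ) x)‖
        ≤ ∑ x ∈ D, φ x (u (t + θ)) * c := Finset.sum_le_sum fun x hx => by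
          rw [norm_smul, Real.norm_of_nonneg (hφ0 _ _)]
          by_cases h0 : φ x (u (t + θ)) = 0
          · simp [h0]
          · refine mul_le_mul_of_nonneg_left (hNδ _ hA.1 _ (hDK hx) _ hA.2 ?_) (hφ0 _ _)
            rw [← dist_eq_norm]
            exact (hφδ _ _ h0).le.trans (min_le_left _ _)
      _ = c := by rw [← Finset.sum_mul, hφK _ hA.1, one_mul]
  · filter_upwards [hut, coeFn_bochnerTransform hbm t,
      ae_shift (ae_norm_nemytskii_le hr.le hb hc hu.aestronglyMeasurable) t,
      ae_shift ((ae_ball_iff (Finset.countable_toSet D)).2 fun x _ => hb x) t]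
      with θ hθ hbθ hfu hfx
    rw [hθ, hbθ]
    set y := u (t + θ)
    set β := b (t + θ)
    have hy : 0 ≤ ‖y‖ ^ r := by positivity
    have hsum : ‖∑ x ∈ D, φ x y • f (t + θ) x‖ ≤ a * (2 ^ r * (‖y‖ ^ r + 1)) + |β| := by
      refine (norm_sum_le _ _).trans ?_
      calc ∑ x ∈ D, ‖φ x y • f (t + θ) x‖
          ≤ ∑ x ∈ D, φ x y * (a * (2 ^ r * (‖y‖ ^ r + 1)) + |β|) :=
            Finset.sum_le_sum fun x hx => by
              rw [norm_smul, Real.norm_of_nonneg (hφ0 _ _)]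
              by_cases h0 : φ x y = 0
              · simp [h0]
              · refine mul_le_mul_of_nonneg_left ((hfx x hx).trans
                  (add_le_add ?_ (le_abs_self _))) (hφ0 _ _)
                have h1 := (hφδ x y h0).le.trans (min_le_right _ _)
                rw [dist_comm, dist_eq_norm] at h1
                have h2 : ‖x‖ ≤ ‖y‖ + 1 := by linarith [norm_sub_norm_le x y]
                exact mul_le_mul_of_nonneg_left ((Real.rpow_le_rpow (norm_nonneg _) h2 hr.le).trans
                  (add_one_rpow_le (norm_nonneg _) hr.le)) ha.le
        _ ≤ a * (2 ^ r * (‖y‖ ^ r + 1)) + |β| := by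
            rw [← Finset.sum_mul]
            exact mul_le_of_le_one_left (by positivity) (hφ1 y)
    have h3 : ‖f (t + θ) y‖ ≤ a * ‖y‖ ^ r + |β| := hfu.trans (by gcongr; exact le_abs_self _)
    refine (norm_sub_le _ _).trans ((add_le_add h3 hsum).trans ?_)
    have h4 : 0 ≤ a * 2 ^ r := by positivity
    nlinarith [mul_nonneg ha.le hy, mul_nonneg h4 hy, mul_nonneg ha.le (abs_nonneg β),
      mul_nonneg h4 (abs_nonneg β)]

theorem tendsto_stepanovNorm_nemytskii [CompleteSpace X] [hp1 : Fact (1 ≤ p)]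
    [hq1 : Fact (1 ≤ q)] (hp : p ≠ ∞) (hq : q ≠ ∞) {f : ℝ → X → Y} {a : ℝ} (ha : 0 < a)
    {b : ℝ → ℝ} (hbm : MemLpLoc q b) (hbT : TotallyBounded (range (bochnerTransform hbm)))
    (hb : ∀ x, ∀ᵐ t, ‖f t x‖ ≤ a * ‖x‖ ^ (p.toReal / q.toReal) + b t)
    (hc : ∀ᵐ t, Continuous (f t))
    (heq : ∀ K : Set X, IsCompact K → ∀ r : ℝ, 0 < r →
      ∃ N : Set ℝ, NullMeasurableSet N volume ∧ supMeas N < ENNReal.ofReal r ∧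
        ∀ ε : ℝ, 0 < ε → ∃ δ : ℝ, 0 < δ ∧ ∀ x₁ ∈ K, ∀ x₂ ∈ K, ∀ t ∉ N,
          ‖x₁ - x₂‖ ≤ δ → ‖f t x₁ - f t x₂‖ ≤ ε)
    {u : ℕ → ℝ → X} {v : ℝ → X} (hu : ∀ n, MemLpLoc p (u n)) (hv : MemLpLoc p v)
    (huT : ∀ n, TotallyBounded (range (bochnerTransform (hu n))))
    (hvT : TotallyBounded (range (bochnerTransform hv)))
    (huv : Tendsto (fun n => stepanovNorm p (fun t => u n t - v t)) atTop (𝓝 0)) :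
    Tendsto (fun n => stepanovNorm q (fun t => nemytskii f (u n) t - nemytskii f v t)) atTop
      (𝓝 0) := by
  have hp0 : p ≠ 0 := (zero_lt_one.trans_le hp1.out).ne'
  have hq0 : q ≠ 0 := (zero_lt_one.trans_le hq1.out).ne'
  have hr : 0 < p.toReal / q.toReal :=
    div_pos (ENNReal.toReal_pos hp0 hp) (ENNReal.toReal_pos hq0 hq)
  have hS := totallyBounded_union_iUnion hvT huT fun ε hε => by
    filter_upwards [huv.eventually_lt_const (pos_iff_ne_zero.2 hε)] with n hn
    rintro _ ⟨t, rfl⟩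
    exact ⟨_, mem_range_self t, (edist_bochnerTransform_le (hu n) hv t).trans_lt hn⟩
  set S := range (bochnerTransform hv) ∪ ⋃ n, range (bochnerTransform (hu n))
  have hvS : ∀ t, bochnerTransform hv t ∈ S := fun t => Or.inl (mem_range_self t)
  have huS : ∀ n t, bochnerTransform (hu n) t ∈ S := fun n t =>
    Or.inr (mem_iUnion.2 ⟨n, mem_range_self t⟩)
  rw [ENNReal.tendsto_nhds_zero]
  intro ε hε
  obtain ⟨δ₀, hδ₀, hcore⟩ := exists_eLpNorm_le_of_dominated (F := Y) hp hq hS hbT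
    (C := a + 2) (ENNReal.half_pos hε.ne').ne'
  have hδ₁ : δ₀ / 4 ≠ 0 := (ENNReal.div_pos hδ₀ (by norm_num)).ne'
  obtain ⟨K, hK, hKu⟩ := exists_isCompact_forall_mem_measure_le hp hS hδ₁
  obtain ⟨s, hs, hsδ⟩ := exists_real_pos_ofReal_le hδ₁
  obtain ⟨N, hNm, hNs, hN⟩ := heq K hK s hs
  obtain ⟨c, hc0, hcε⟩ := exists_real_pos_ofReal_le (ENNReal.half_pos hε.ne').ne'
  obtain ⟨δ, hδ, hNδ⟩ := hN c hc0
  filter_upwards [huv.eventually_le_const (pos_iff_ne_zero.2 (mul_ne_zero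
    (ENNReal.ofReal_pos.2 hδ).ne' (rpow_inv_ne_zero (ENNReal.toReal_pos hp0 hp) hδ₁)))] with n hn
  refine iSup_le fun t => ?_
  have hut := coeFn_bochnerTransform (hu n) t
  have hvt := coeFn_bochnerTransform hv t
  -- Four bad sets of measure at most `δ₀ / 4`: either function outside `K`, time in `N`, and `‖u n
  -- - v‖ ≥ δ`, the last by Chebyshev.
  refine (hcore _ (huS n t) _ (hvS t) _ (mem_range_self t)
    (({θ | bochnerTransform (hu n) t θ ∉ K} ∪ {θ | bochnerTransform hv t θ ∉ K}) ∪
      ({θ | t + θ ∈ N} ∪ {θ | δ ≤ ‖u n (t + θ) - v (t + θ)‖})) ?_ _ c hc0.le ?_ ?_).trans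
    ((add_le_add_left hcε _).trans (ENNReal.add_halves ε).le)
  · refine (measure_union_le _ _).trans ((add_le_add (measure_union_le _ _)
      (measure_union_le _ _)).trans ((add_le_add (add_le_add (hKu _ (huS n t)) (hKu _ (hvS t)))
      (add_le_add ((unitMeasure_shift_le_supMeas hNm t).trans (hNs.le.trans hsδ))
      (measure_le_of_eLpNorm_le hp0 hp (((hu n).memLp_shift t).1.sub (hv.memLp_shift t).1) hδ
        ((le_iSup (fun t : ℝ => eLpNorm (fun θ : ℝ => u n (t + θ) - v (t + θ)) p unitMeasure)
          t).trans hn)))).trans_eq ?_))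
    rw [← two_mul, ← two_mul, ← mul_assoc, show (2 * 2 : ℝ≥0∞) = 4 by norm_num]
    exact ENNReal.mul_div_cancel (by norm_num) (by norm_num)
  · filter_upwards [hut, hvt] with θ hθ hθ' hA
    simp only [mem_union, mem_ofPred_eq, hθ, hθ', not_or, not_not, not_le] at hA
    exact hNδ _ hA.1.1 _ hA.1.2 _ hA.2.1 hA.2.2.le
  · filter_upwards [hut, hvt, coeFn_bochnerTransform hbm t,
      ae_shift (ae_norm_nemytskii_le hr.le hb hc (hu n).aestronglyMeasurable) t,
      ae_shift (ae_norm_nemytskii_le hr.le hb hc hv.aestronglyMeasurable) t]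
      with θ hθ hθ' hbθ hfu hfv
    rw [hθ, hθ', hbθ]
    refine (norm_sub_le _ _).trans ((add_le_add hfu hfv).trans ?_)
    have h1 : 0 ≤ ‖u n (t + θ)‖ ^ (p.toReal / q.toReal) := by positivity
    have h2 : 0 ≤ ‖v (t + θ)‖ ^ (p.toReal / q.toReal) := by positivity
    nlinarith [le_abs_self (b (t + θ)), mul_nonneg ha.le (abs_nonneg (b (t + θ)))]

end Nemytskii

/-! ### Stability properties of the Stepanov spaces. -/

section Spaces

variable {X Y : Type*} [NormedAddCommGroup X] [NormedAddCommGroup Y] [NormedSpace ℝ Y]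
  {p q : ℝ≥0∞}

theorem MemLpLoc.congr {u v : ℝ → X} (hu : MemLpLoc p u) (h : u =ᵐ[volume] v) : MemLpLoc p v :=
  fun a b => (hu a b).ae_eq (ae_restrict_of_ae h)

theorem MemLpLoc.add {u v : ℝ → X} (hu : MemLpLoc p u) (hv : MemLpLoc p v) :
    MemLpLoc p (fun t => u t + v t) :=
  fun a b => (hu a b).add (hv a b)

theorem MemLpLoc.comp_smul {φ : X → ℝ} (hφ : Continuous φ) (hφ1 : ∀ x, |φ x| ≤ 1) {u : ℝ → X}
    (hu : MemLpLoc p u) {g : ℝ → Y} (hg : MemLpLoc q g) :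
    MemLpLoc q (fun t => φ (u t) • g t) :=
  fun a b => memLp_comp_smul hφ hφ1 (hu a b).1 (hg a b)

theorem bochnerTransform_congr {u v : ℝ → X} (hu : MemLpLoc p u) (hv : MemLpLoc p v)
    (h : u =ᵐ[volume] v) : bochnerTransform hu = bochnerTransform hv :=
  funext fun t => MemLp.toLp_congr _ _ (ae_shift h t)

theorem bochnerTransform_add {u v : ℝ → X} (hu : MemLpLoc p u) (hv : MemLpLoc p v) :
    bochnerTransform (hu.add hv) = fun t => bochnerTransform hu t + bochnerTransform hv t :=
  rfl

theorem bochnerTransform_comp_smul {φ : X → ℝ} (hφ : Continuous φ) (hφ1 : ∀ x, |φ x| ≤ 1)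
    {u : ℝ → X} (hu : MemLpLoc p u) {g : ℝ → Y} (hg : MemLpLoc q g) :
    bochnerTransform (hu.comp_smul hφ hφ1 hg) =
      fun t => compSmulLp hφ hφ1 (bochnerTransform hu t, bochnerTransform hg t) := by
  ext1 t
  refine MemLp.toLp_congr _ _ ?_
  filter_upwards [coeFn_bochnerTransform hu t, coeFn_bochnerTransform hg t] with θ h1 h2
  rw [h1, h2]

theorem stepanovNorm_congr {u v : ℝ → X} (h : u =ᵐ[volume] v) :
    stepanovNorm p u = stepanovNorm p v :=
  iSup_congr fun t => eLpNorm_congr_ae (ae_shift h t)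

theorem memLpLoc_zero : MemLpLoc p (fun _ : ℝ => (0 : X)) := fun _ _ => MemLp.zero

theorem stepanovEDist_eq {u v : ℝ →ₘ[volume] X} {u' v' : ℝ → X} (hu : u =ᵐ[volume] u')
    (hv : v =ᵐ[volume] v') : stepanovEDist p u v = stepanovNorm p (fun t => u' t - v' t) :=
  stepanovNorm_congr (hu.sub hv)

theorem bochnerTransform_zero :
    bochnerTransform (memLpLoc_zero : MemLpLoc p (fun _ : ℝ => (0 : X))) = fun _ => 0 :=
  rfl

variable [Fact (1 ≤ p)] [Fact (1 ≤ q)]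

/-- Stepanov approximation is uniform approximation of Bochner transforms, so closure under uniform
limits applies. -/
theorem norm_bochnerTransform_sub_le {u v : ℝ → X} (hu : MemLpLoc p u) (hv : MemLpLoc p v)
    {ε : ℝ} (hε : 0 ≤ ε) (h : stepanovNorm p (fun t => u t - v t) ≤ ENNReal.ofReal ε) (t : ℝ) :
    ‖bochnerTransform hu t - bochnerTransform hv t‖ ≤ ε := by
  rw [← dist_eq_norm, ← ENNReal.ofReal_le_ofReal_iff hε, ← edist_dist]
  exact (edist_bochnerTransform_le hu hv t).trans h

theorem MemSaa.congr {u v : ℝ → X} (hu : MemSaa p u) (h : u =ᵐ[volume] v) : MemSaa p v :=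
  ⟨hu.1.congr h, bochnerTransform_congr hu.1 (hu.1.congr h) h ▸ hu.2⟩

theorem MemSap.congr {u v : ℝ → X} (hu : MemSap p u) (h : u =ᵐ[volume] v) : MemSap p v :=
  ⟨hu.1.congr h, bochnerTransform_congr hu.1 (hu.1.congr h) h ▸ hu.2⟩

theorem MemSaa.add {u v : ℝ → X} (hu : MemSaa p u) (hv : MemSaa p v) :
    MemSaa p (fun t => u t + v t) :=
  ⟨hu.1.add hv.1, bochnerTransform_add hu.1 hv.1 ▸ (hu.2.prodMk hv.2).comp continuous_add⟩

theorem MemSap.add [CompleteSpace X] {u v : ℝ → X} (hu : MemSap p u) (hv : MemSap p v) :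
    MemSap p (fun t => u t + v t) :=
  ⟨hu.1.add hv.1, bochnerTransform_add hu.1 hv.1 ▸ (hu.2.prodMk hv.2).comp continuous_add⟩

theorem MemSaa.comp_smul (hq : q ≠ ∞) {φ : X → ℝ} (hφ : Continuous φ) (hφ1 : ∀ x, |φ x| ≤ 1)
    {u : ℝ → X} (hu : MemSaa p u) {g : ℝ → Y} (hg : MemSaa q g) :
    MemSaa q (fun t => φ (u t) • g t) :=
  ⟨hu.1.comp_smul hφ hφ1 hg.1, bochnerTransform_comp_smul hφ hφ1 hu.1 hg.1 ▸
    (hu.2.prodMk hg.2).comp (continuous_compSmulLp hq hφ hφ1)⟩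

theorem MemSap.comp_smul [CompleteSpace X] [CompleteSpace Y] (hq : q ≠ ∞) {φ : X → ℝ}
    (hφ : Continuous φ) (hφ1 : ∀ x, |φ x| ≤ 1) {u : ℝ → X} (hu : MemSap p u) {g : ℝ → Y}
    (hg : MemSap q g) : MemSap q (fun t => φ (u t) • g t) :=
  ⟨hu.1.comp_smul hφ hφ1 hg.1, bochnerTransform_comp_smul hφ hφ1 hu.1 hg.1 ▸
    (hu.2.prodMk hg.2).comp (continuous_compSmulLp hq hφ hφ1)⟩

theorem memSaa_zero : MemSaa p (fun _ : ℝ => (0 : X)) :=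
  ⟨memLpLoc_zero, bochnerTransform_zero (X := X) (p := p) ▸ ⟨continuous_const, fun _ =>
    ⟨id, strictMono_id, 0, fun _ => ⟨tendsto_const_nhds, tendsto_const_nhds⟩⟩⟩⟩

theorem memSap_zero : MemSap p (fun _ : ℝ => (0 : X)) :=
  ⟨memLpLoc_zero, bochnerTransform_zero (X := X) (p := p) ▸
    isAlmostPeriodic_of_finite_net continuous_const fun ε hε =>
      ⟨{0}, finite_singleton 0, fun _ => ⟨0, rfl, fun _ => by simpa using hε.le⟩⟩⟩

theorem MemSaa.sum {ι : Type*} {D : Finset ι} {u : ι → ℝ → X} (hu : ∀ i ∈ D, MemSaa p (u i)) :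
    MemSaa p (fun t => ∑ i ∈ D, u i t) := by
  classical
  induction D using Finset.induction_on with
  | empty => simpa using memSaa_zero
  | insert i D hi ih =>
    simp only [Finset.sum_insert hi]
    exact (hu i (Finset.mem_insert_self i D)).add
      (ih fun j hj => hu j (Finset.mem_insert_of_mem hj))

theorem MemSap.sum [CompleteSpace X] {ι : Type*} {D : Finset ι} {u : ι → ℝ → X}
    (hu : ∀ i ∈ D, MemSap p (u i)) : MemSap p (fun t => ∑ i ∈ D, u i t) := by
  classical
  induction D using Finset.induction_on with
  | empty => simpa using memSap_zero
  | insert i D hi ih =>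
    simp only [Finset.sum_insert hi]
    exact (hu i (Finset.mem_insert_self i D)).add
      (ih fun j hj => hu j (Finset.mem_insert_of_mem hj))

theorem memSaa_of_forall_exists_stepanovNorm_sub_le [CompleteSpace X] {u : ℝ → X}
    (hu : MemLpLoc p u) (h : ∀ ε : ℝ≥0∞, ε ≠ 0 →
      ∃ v : ℝ → X, MemSaa p v ∧ stepanovNorm p (fun t => u t - v t) ≤ ε) : MemSaa p u := by
  refine ⟨hu, isAlmostAutomorphic_of_forall_exists_norm_sub_le fun ε hε => ?_⟩
  obtain ⟨v, ⟨hvm, hv⟩, huv⟩ := h (ENNReal.ofReal ε) (ENNReal.ofReal_pos.2 hε).ne'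
  exact ⟨_, hv, norm_bochnerTransform_sub_le hu hvm hε.le huv⟩

theorem memSap_of_forall_exists_stepanovNorm_sub_le {u : ℝ → X}
    (hu : MemLpLoc p u) (h : ∀ ε : ℝ≥0∞, ε ≠ 0 →
      ∃ v : ℝ → X, MemSap p v ∧ stepanovNorm p (fun t => u t - v t) ≤ ε) : MemSap p u := by
  refine ⟨hu, isAlmostPeriodic_of_forall_exists_norm_sub_le fun ε hε => ?_⟩
  obtain ⟨v, ⟨hvm, hv⟩, huv⟩ := h (ENNReal.ofReal ε) (ENNReal.ofReal_pos.2 hε).ne'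
  exact ⟨_, hv, norm_bochnerTransform_sub_le hu hvm hε.le huv⟩

end Spaces

end Stepanov

theorem mainTheorem4
    {X Y : Type*}
    [NormedAddCommGroup X] [NormedSpace ℝ X] [CompleteSpace X]
    [NormedAddCommGroup Y] [NormedSpace ℝ Y] [CompleteSpace Y]
    (p q : ℝ≥0∞) [Fact (1 ≤ p)] [Fact (1 ≤ q)] (hp : p ≠ ∞) (hq : q ≠ ∞)
    (f : ℝ → X → Y)
    (H1 : ∃ a : ℝ, 0 < a ∧ ∃ b : ℝ → ℝ, Stepanov.MemSaa q b ∧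
      ∀ x : X, ∀ᵐ t : ℝ, ‖f t x‖ ≤ a * ‖x‖ ^ (p.toReal / q.toReal) + b t)
    (H2 : ∀ᵐ t : ℝ, Continuous (f t))
    (H3 : ∀ K : Set X, IsCompact K → ∀ r : ℝ, 0 < r →
      ∃ N : Set ℝ, NullMeasurableSet N volume ∧
        Stepanov.supMeas N < ENNReal.ofReal r ∧
        ∀ ε : ℝ, 0 < ε → ∃ δ : ℝ, 0 < δ ∧ ∀ x₁ ∈ K, ∀ x₂ ∈ K, ∀ t ∉ N,
          ‖x₁ - x₂‖ ≤ δ → ‖f t x₁ - f t x₂‖ ≤ ε) :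
    ((∀ x : X, Stepanov.MemSaa q (fun t => f t x)) →
      (∀ u : ℝ → X, Stepanov.MemSaa p u → Stepanov.MemSaa q (Stepanov.nemytskii f u)) ∧
      ∃ 𝒩 : Stepanov.Saa p X → Stepanov.Saa q Y,
        (∀ u, (𝒩 u).toAEEqFun =ᵐ[volume] Stepanov.nemytskii f u.toAEEqFun) ∧ Continuous 𝒩) ∧
    ((∀ x : X, Stepanov.MemSap q (fun t => f t x)) →
      (∀ u : ℝ → X, Stepanov.MemSap p u → Stepanov.MemSap q (Stepanov.nemytskii f u)) ∧
      ∃ 𝒩 : Stepanov.Sap p X → Stepanov.Sap q Y,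
        (∀ u, (𝒩 u).toAEEqFun =ᵐ[volume] Stepanov.nemytskii f u.toAEEqFun) ∧ Continuous 𝒩) := by
  open Stepanov in
  obtain ⟨a, ha, b, ⟨hbm, hbaa⟩, hb⟩ := H1
  -- Besides local integrability, this is all that both cases use of `b`; almost automorphy
  -- therefore suffices in the almost periodic case too.
  have hbT := hbaa.totallyBounded_range
  constructor
  · intro hf
    have hfm : ∀ x, AEStronglyMeasurable (fun t => f t x) volume := fun x =>
      (hf x).1.aestronglyMeasurable
    have hmem : ∀ u : ℝ → X, MemSaa p u → MemSaa q (nemytskii f u) := fun u hu => by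
      refine memSaa_of_forall_exists_stepanovNorm_sub_le
        (memLpLoc_nemytskii hp hq hbm hb H2 hfm hu.1) fun ε hε => ?_
      obtain ⟨D, φ, hφ, hφ1, h⟩ := exists_stepanovNorm_nemytskii_sub_sum_le hp hq ha hbm hbT hb H2
        H3 hu.1 hu.2.totallyBounded_range hε
      exact ⟨_, MemSaa.sum fun x hx => hu.comp_smul hq (hφ x) (hφ1 x hx) (hf x), h⟩
    refine ⟨hmem, fun u => ⟨AEEqFun.mk _ (hmem _ u.mem).1.aestronglyMeasurable,
      (hmem _ u.mem).congr (AEEqFun.coeFn_mk _ _).symm⟩, fun u => AEEqFun.coeFn_mk _ _, ?_⟩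
    rw [continuous_iff_seqContinuous]
    intro u v huv
    rw [tendsto_iff_edist_tendsto_0] at huv ⊢
    refine (tendsto_stepanovNorm_nemytskii hp hq ha hbm hbT hb H2 H3 (fun n => (u n).mem.1) v.mem.1
      (fun n => (u n).mem.2.totallyBounded_range) v.mem.2.totallyBounded_range huv).congr
      fun n => ?_
    exact (stepanovEDist_eq (AEEqFun.coeFn_mk _ _) (AEEqFun.coeFn_mk _ _)).symm
  · intro hf
    have hfm : ∀ x, AEStronglyMeasurable (fun t => f t x) volume := fun x =>
      (hf x).1.aestronglyMeasurable
    have hmem : ∀ u : ℝ → X, MemSap p u → MemSap q (nemytskii f u) := fun u hu => by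
      refine memSap_of_forall_exists_stepanovNorm_sub_le
        (memLpLoc_nemytskii hp hq hbm hb H2 hfm hu.1) fun ε hε => ?_
      obtain ⟨D, φ, hφ, hφ1, h⟩ := exists_stepanovNorm_nemytskii_sub_sum_le hp hq ha hbm hbT hb H2
        H3 hu.1 hu.2.totallyBounded_range hε
      exact ⟨_, MemSap.sum fun x hx => hu.comp_smul hq (hφ x) (hφ1 x hx) (hf x), h⟩
    refine ⟨hmem, fun u => ⟨AEEqFun.mk _ (hmem _ u.mem).1.aestronglyMeasurable,
      (hmem _ u.mem).congr (AEEqFun.coeFn_mk _ _).symm⟩, fun u => AEEqFun.coeFn_mk _ _, ?_⟩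
    rw [continuous_iff_seqContinuous]
    intro u v huv
    rw [tendsto_iff_edist_tendsto_0] at huv ⊢
    refine (tendsto_stepanovNorm_nemytskii hp hq ha hbm hbT hb H2 H3 (fun n => (u n).mem.1) v.mem.1
      (fun n => (u n).mem.2.totallyBounded_range) v.mem.2.totallyBounded_range huv).congr
      fun n => ?_
    exact (stepanovEDist_eq (AEEqFun.coeFn_mk _ _) (AEEqFun.coeFn_mk _ _)).symm
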